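/- Let $Q\subseteq\mathbb Z^N$ be an affine monoid, i.e. a finitely generated submonoid, and let $\operatorname{gp}(F)$ denote the subgroup of $\mathbb Z^N$ generated by a subset $F$. A face of $Q$ is a nonempty subset $F\subseteq Q$ such that for all $a,b\in Q$: $a+b\in F$ if and only if $a\in F$ and $b\in F$. A $Q$-module in $\operatorname{gp}(Q)$ is a subset $M\subseteq \operatorname{gp}(Q)$ with $Q+M\subseteq M$; it is finitely generated if $M=Q+B$ for a finite set $B$. For a field $k$, let $k[M]$ be the $k$-vector space with basis $\{x^m : m\in M\}$, a module over the monoid algebra $k[Q]$ through $x^q x^m=x^{q+m}$, and for a face $F$ let $\mathfrak p_F\subseteq k[Q]$ be the prime ideal spanned over $k$ by the $x^q$ with $q\in Q\setminus F$. The multiplicity of a prime $\mathfrak p$ on a module $K$ is the length over $k[Q]_{\mathfrak p}$ of the localization at $\mathfrak p$ of $H^0_{\mathfrak p}(K)=\{x\in K:\mathfrak p^n x=0\text{ for some } n\}$. Theorem. Let $M\subseteq\operatorname{gp}(Q)$ be a finitely generated $Q$-module and $U\subseteq M$ a submodule. Then there is an irredundant finite decomposition $$M\setminus U=\bigcup_{i=1}^r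 (\operatorname{gp}(F_i)+m_i)\cap M$$ with faces $F_i$ of $Q$ and $m_i\in\operatorname{gp}(Q)$ (irredundant: no piece can be omitted). It is unique: in any two such decompositions the faces $F_i$ together with the sets $\operatorname{gp}(F_i)+m_i$ agree up to reordering. Moreover: (1) For every field $k$ and every face $F$ of $Q$, the number of indices $i$ with $F_i=F$ equals the multiplicity of $\mathfrak p_F$ on $k[M]/k[U]$. In particular, $F$ occurs among the $F_i$ if and only if $\mathfrak p_F$ is an associated prime of $k[M]/k[U]$. (2) For every face $F$ of $Q$ and every $m\in M$, the set $\operatorname{gp}(F)+m$ occurs in the decomposition (as $\operatorname{gp}(F_i)+m_i$ with $F_i=F$) if and only if $F$ is a maximal face with $F+m\subseteq M\setminus U$. The normalization $\overline Q=\operatorname{gp}(Q)\cap\operatorname{cone}(Q)$, where $\operatorname{cone}(Q)\subseteq\mathbb R^N$ is the convex cone generated by $Q$, is a finitely generated $Q$-module in $\operatorname{gp}(Q)$ that contains $Q$ as a submodule, so that the above applies to $M=\overline Q$, $U=Q$; the sets $\operatorname{gp}(F_i)+m_i$ are then called the families of holes of $Q$. -/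

import Mathlib

noncomputable section

namespace AffineMonoid

/-- A face of the monoid `Q`: a nonempty subset `F ⊆ Q` such that, for `a, b ∈ Q`,
`a + b ∈ F` if and only if `a ∈ F` and `b ∈ F`. -/
@[ext]
structure Face {N : ℕ} (Q : AddSubmonoid (Fin N → ℤ)) where
  carrier : Set (Fin N → ℤ)
  nonempty : carrier.Nonempty
  subset : carrier ⊆ (Q : Set (Fin N → ℤ))
  add_mem_iff : ∀ a ∈ Q, ∀ b ∈ Q, a + b ∈ carrier ↔ a ∈ carrier ∧ b ∈ carrier

/-- A `Q`-module contained in `gp(Q)`: a subset of `gp(Q)` that is stable under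
translation by elements of `Q`. -/
@[ext]
structure QModule {N : ℕ} (Q : AddSubmonoid (Fin N → ℤ)) where
  carrier : Set (Fin N → ℤ)
  subset_gp : ∀ m ∈ carrier, m ∈ AddSubgroup.closure (Q : Set (Fin N → ℤ))
  add_mem : ∀ q ∈ Q, ∀ m ∈ carrier, q + m ∈ carrier

/-- `M = Q + B` for a finite set `B`. -/
def QModule.FG {N : ℕ} {Q : AddSubmonoid (Fin N → ℤ)} (M : QModule Q) : Prop :=
  ∃ B : Finset (Fin N → ℤ), M.carrier = {x | ∃ q ∈ Q, ∃ b ∈ B, x = q + b}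

/-- The monoid `Q` as a module over itself. -/
def QModule.self {N : ℕ} (Q : AddSubmonoid (Fin N → ℤ)) : QModule Q where
  carrier := Q
  subset_gp _ hm := AddSubgroup.subset_closure hm
  add_mem _ hq _ hm := Q.add_mem hq hm

/-- The set `gp(F) + m`. -/
def Face.translate {N : ℕ} {Q : AddSubmonoid (Fin N → ℤ)} (F : Face Q) (m : Fin N → ℤ) :
    Set (Fin N → ℤ) :=
  {x | ∃ f ∈ AddSubgroup.closure F.carrier, x = f + m}

/-- `M ∖ U = ⋃ i, (gp(F i) + m i) ∩ M` with `m i ∈ gp(Q)`, and no piece can be omitted. -/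
structure IsIrredundantDecomposition {N : ℕ} {Q : AddSubmonoid (Fin N → ℤ)} (M U : QModule Q)
    {r : ℕ} (F : Fin r → Face Q) (m : Fin r → (Fin N → ℤ)) : Prop where
  mem_gp : ∀ i, m i ∈ AddSubgroup.closure (Q : Set (Fin N → ℤ))
  eq_iUnion : M.carrier \ U.carrier = ⋃ i, (F i).translate (m i) ∩ M.carrier
  irredundant : ∀ j,
    M.carrier \ U.carrier ≠ ⋃ i ∈ {i | i ≠ j}, (F i).translate (m i) ∩ M.carrier

/-- The convex cone generated by `Q` in `ℝ^N`. -/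
def cone {N : ℕ} (Q : AddSubmonoid (Fin N → ℤ)) : PointedCone ℝ (Fin N → ℝ) :=
  PointedCone.hull ℝ ((fun (x : Fin N → ℤ) (i : Fin N) => (x i : ℝ)) '' (Q : Set (Fin N → ℤ)))

/-- The normalization `gp(Q) ∩ cone(Q)` of `Q`, as a `Q`-module. -/
def normalization {N : ℕ} (Q : AddSubmonoid (Fin N → ℤ)) : QModule Q where
  carrier := {x | x ∈ AddSubgroup.closure (Q : Set (Fin N → ℤ)) ∧
    (fun i => (x i : ℝ)) ∈ cone Q}
  subset_gp _ hm := hm.1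
  add_mem q hq m hm := by
    refine ⟨AddSubgroup.add_mem _ (AddSubgroup.subset_closure hq) hm.1, ?_⟩
    have h : (fun i => (q i : ℝ)) ∈ cone Q := Submodule.subset_span ⟨q, hq, rfl⟩
    have h2 := (cone Q).add_mem h hm.2
    convert h2 using 1
    ext i
    simp

/-! ### The monoid algebra and its modules -/

/-- `k[ℤ^N]` as a module over the monoid algebra `k[Q]`, through the inclusion `Q ⊆ ℤ^N`. -/
instance groupAlgebraModule {N : ℕ} (k : Type*) [Field k] (Q : AddSubmonoid (Fin N → ℤ)) :
    Module (AddMonoidAlgebra k Q) (AddMonoidAlgebra k (Fin N → ℤ)) :=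
  Module.compHom _ (AddMonoidAlgebra.mapDomainRingHom k Q.subtype)

/-- On monomials the action is `x^q • x^m = x^(q + m)`. -/
theorem single_smul_single {N : ℕ} (k : Type*) [Field k] (Q : AddSubmonoid (Fin N → ℤ))
    (q : Q) (m : Fin N → ℤ) (a b : k) :
    (AddMonoidAlgebra.single q a : AddMonoidAlgebra k Q) •
      (AddMonoidAlgebra.single m b : AddMonoidAlgebra k (Fin N → ℤ)) =
      AddMonoidAlgebra.single ((q : Fin N → ℤ) + m) (a * b) := by
  change AddMonoidAlgebra.mapDomainRingHom k Q.subtype (AddMonoidAlgebra.single q a) *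
    AddMonoidAlgebra.single m b = _
  simp [AddMonoidAlgebra.single_mul_single]

/-- The `k[Q]`-module `k[M]`: the elements of `k[ℤ^N]` all of whose monomials lie in `M`. -/
def QModule.linearization {N : ℕ} (k : Type*) [Field k] {Q : AddSubmonoid (Fin N → ℤ)}
    (M : QModule Q) :
    Submodule (AddMonoidAlgebra k Q) (AddMonoidAlgebra k (Fin N → ℤ)) where
  carrier := {f | ∀ x, x ∉ M.carrier → f.coeff x = 0}
  zero_mem' := by simp
  add_mem' := by
    intro f g hf hg x hx
    simp [hf x hx, hg x hx]
  smul_mem' := by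
    intro a f hf
    induction a using AddMonoidAlgebra.induction_linear with
    | zero => intro x _; simp
    | add a b ha hb =>
      intro x hx
      rw [add_smul]
      simp [ha x hx, hb x hx]
    | single q r =>
      intro x hx
      change (AddMonoidAlgebra.mapDomainRingHom k Q.subtype (AddMonoidAlgebra.single q r) *
        f).coeff x = 0
      have h : -(q : Fin N → ℤ) + x ∉ M.carrier := fun h => hx (by
        have := M.add_mem q q.2 _ h
        rwa [add_neg_cancel_left] at this)
      simp [AddMonoidAlgebra.coeff_single_mul_apply, hf _ h]

/-- The quotient module `k[M]/k[U]` (meaningful for `U ⊆ M`). -/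
abbrev quotientModule {N : ℕ} (k : Type*) [Field k] {Q : AddSubmonoid (Fin N → ℤ)}
    (M U : QModule Q) : Type _ :=
  M.linearization k ⧸ (U.linearization k).submoduleOf (M.linearization k)

/-- The ideal `p_F` of `k[Q]` spanned over `k` by the monomials `x^q` with `q ∈ Q ∖ F`. -/
def Face.ideal {N : ℕ} (k : Type*) [Field k] {Q : AddSubmonoid (Fin N → ℤ)} (F : Face Q) :
    Ideal (AddMonoidAlgebra k Q) where
  carrier := {f | ∀ q : Q, (q : Fin N → ℤ) ∈ F.carrier → f.coeff q = 0}
  zero_mem' := by simp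
  add_mem' := by
    intro f g hf hg x hx
    simp [hf x hx, hg x hx]
  smul_mem' := by
    intro a f hf
    induction a using AddMonoidAlgebra.induction_linear with
    | zero => intro x _; simp
    | add a b ha hb =>
      intro x hx
      have h1 := ha x hx
      have h2 := hb x hx
      rw [smul_eq_mul] at h1 h2
      rw [smul_eq_mul, add_mul, AddMonoidAlgebra.coeff_add, Finsupp.add_apply, h1, h2, add_zero]
    | single q r =>
      intro x hx
      by_cases h : ∃ d, q + d = x
      · obtain ⟨d, rfl⟩ := h
        have hd := (F.add_mem_iff q q.2 d d.2).1 hx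
        rw [smul_eq_mul, AddMonoidAlgebra.coeff_single_mul_add, hf d hd.2, mul_zero]
      · push Not at h
        exact AddMonoidAlgebra.coeff_single_mul_of_forall_add_ne _ _ h

instance Face.ideal_isPrime {N : ℕ} (k : Type*) [Field k] {Q : AddSubmonoid (Fin N → ℤ)}
    (F : Face Q) : (F.ideal k).IsPrime := by
  classical
  have h0 : (0 : Fin N → ℤ) ∈ F.carrier := by
    obtain ⟨a, ha⟩ := F.nonempty
    exact ((F.add_mem_iff a (F.subset ha) 0 Q.zero_mem).1 (by simpa using ha)).2
  let χ : Multiplicative Q →* AddMonoidAlgebra k (Fin N → ℤ) :=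
    { toFun := fun q => if ((q.toAdd : Q) : Fin N → ℤ) ∈ F.carrier then
        AddMonoidAlgebra.single ((q.toAdd : Q) : Fin N → ℤ) 1 else 0
      map_one' := by
        simp [h0, AddMonoidAlgebra.one_def]
      map_mul' := by
        intro a b
        have h := F.add_mem_iff (a.toAdd : Q) (a.toAdd : Q).2 (b.toAdd : Q) (b.toAdd : Q).2
        by_cases ha : ((a.toAdd : Q) : Fin N → ℤ) ∈ F.carrier <;>
        by_cases hb : ((b.toAdd : Q) : Fin N → ℤ) ∈ F.carrier <;>
        simp [h, ha, hb, AddMonoidAlgebra.single_mul_single] }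
  let φ := AddMonoidAlgebra.lift k (AddMonoidAlgebra k (Fin N → ℤ)) Q χ
  have hφ : ∀ (q : Q) (r : k), φ (AddMonoidAlgebra.single q r) =
      if (q : Fin N → ℤ) ∈ F.carrier then AddMonoidAlgebra.single (q : Fin N → ℤ) r else 0 := by
    intro q r
    have : φ (AddMonoidAlgebra.single q r) = r • χ (Multiplicative.ofAdd q) := by
      simp [φ, AddMonoidAlgebra.lift_single]
    rw [this]
    by_cases hq : (q : Fin N → ℤ) ∈ F.carrier <;> simp [χ, hq]
  have h1 : ∀ (f : AddMonoidAlgebra k Q) (q : Q), (q : Fin N → ℤ) ∈ F.carrier →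
      (φ f).coeff q = f.coeff q := by
    intro f q hq
    induction f using AddMonoidAlgebra.induction_linear with
    | zero => simp
    | add a b ha hb => simp [ha, hb]
    | single p r =>
      rw [hφ]
      by_cases hpq : p = q
      · subst hpq; simp [hq]
      · have : (p : Fin N → ℤ) ≠ q := fun h => hpq (Subtype.ext h)
        split_ifs <;> simp [AddMonoidAlgebra.coeff_single, hpq, this]
  have h2 : ∀ (f : AddMonoidAlgebra k Q) (x : Fin N → ℤ), x ∉ F.carrier →
      (φ f).coeff x = 0 := by
    intro f x hx
    induction f using AddMonoidAlgebra.induction_linear with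
    | zero => simp
    | add a b ha hb => simp [ha, hb]
    | single p r =>
      rw [hφ]
      split_ifs with hp
      · have : (p : Fin N → ℤ) ≠ x := fun h => hx (h ▸ hp)
        simp [AddMonoidAlgebra.coeff_single, this]
      · simp
  have hker : F.ideal k = RingHom.ker φ := by
    ext f
    rw [RingHom.mem_ker]
    constructor
    · intro hf
      ext x
      by_cases hx : x ∈ F.carrier
      · have := h1 f ⟨x, F.subset hx⟩ hx
        simpa [hf ⟨x, F.subset hx⟩ hx] using this
      · simpa using h2 f x hx
    · intro hf q hq
      rw [← h1 f q hq, hf]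
      simp
  rw [hker]
  exact RingHom.ker_isPrime _

/-- `H⁰_p(K)`: the elements of `K` that are annihilated by a power of the ideal `p`. -/
def powerTorsion {R K : Type*} [CommRing R] [AddCommGroup K] [Module R K] (p : Ideal R) :
    Submodule R K where
  carrier := {x | ∃ n : ℕ, ∀ a ∈ p ^ n, a • x = 0}
  zero_mem' := ⟨0, by simp⟩
  add_mem' := by
    rintro x y ⟨n, hn⟩ ⟨l, hl⟩
    refine ⟨n + l, fun a ha => ?_⟩
    rw [smul_add, hn a (Ideal.pow_le_pow_right (Nat.le_add_right n l) ha),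
      hl a (Ideal.pow_le_pow_right (Nat.le_add_left l n) ha), add_zero]
  smul_mem' := by
    rintro c x ⟨n, hn⟩
    exact ⟨n, fun a ha => by rw [smul_comm, hn a ha, smul_zero]⟩

/-- The multiplicity of the prime `p` on the module `K`: the length over `R_p` of the
localization of `H⁰_p(K)` at `p`. -/
def primeMultiplicity {R : Type*} (K : Type*) [CommRing R] [AddCommGroup K] [Module R K]
    (p : Ideal R) [p.IsPrime] : ℕ∞ :=
  Module.length (Localization.AtPrime p)
    (LocalizedModule p.primeCompl (powerTorsion p : Submodule R K))

end AffineMonoid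

end

/-! The pieces can be described without mentioning a decomposition: they are the cosets `gp(G) + n`
with `n ∈ M` and `G` maximal among the faces for which `G + n` misses `U` (`pieces`). The tool is
the covering lemma `Face.exists_subset_of_cover`: if finitely many cosets of face groups cover `G +
n`, one of them contains `gp(G) + n`, by pigeonhole along the multiples of an element interior to
`G`. It identifies every irredundant decomposition with `pieces` (`range_eq`), whence uniqueness and
the geometric characterization. It also shows that `pieces`, once known to be finite, is an
irredundant decomposition.

Finiteness and multiplicities follow from the same Noetherian induction. The pieces with face `F`
are the cosets `gp(F) + n` with `F + n` missing `U` and `n` in the `F`-primary part `M'` of `M`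
(`maximalCosets_eq`), and `k[M']/k[U]` is the `p_F`-power torsion of `k[M]/k[U]`. A finite chain
leads from `U` to `M'`, each step adjoining one set `G + m` disjoint from the previous module, with
subquotient `k[Q]/p_G`. A step with `G = F` contributes one coset and length one at `p_F`; every
other step contributes neither.

For associated primes, a monomial with maximal annihilator is chosen inside the primary part
(`IsMaximalAt.exists_annihilator_eq`). -/

namespace AffineMonoid

section Combinatorics

variable {N : ℕ} {Q : AddSubmonoid (Fin N → ℤ)}

/-! ### Faces, the groups they generate, and the covering lemma -/

namespace Face

theorem zero_mem (F : Face Q) : (0 : Fin N → ℤ) ∈ F.carrier := by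
  obtain ⟨a, ha⟩ := F.nonempty
  exact ((F.add_mem_iff a (F.subset ha) 0 Q.zero_mem).1 (by simpa using ha)).2

theorem add_mem (F : Face Q) {a b : Fin N → ℤ} (ha : a ∈ F.carrier) (hb : b ∈ F.carrier) :
    a + b ∈ F.carrier :=
  (F.add_mem_iff a (F.subset ha) b (F.subset hb)).2 ⟨ha, hb⟩

theorem nsmul_mem (F : Face Q) {a : Fin N → ℤ} (ha : a ∈ F.carrier) (n : ℕ) :
    n • a ∈ F.carrier := by
  induction n with
  | zero => simpa using F.zero_mem
  | succ n ih => rw [succ_nsmul]; exact F.add_mem ih ha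

theorem mem_of_nsmul_mem (F : Face Q) {a : Fin N → ℤ} (ha : a ∈ Q) {n : ℕ} (hn : n ≠ 0)
    (h : n • a ∈ F.carrier) : a ∈ F.carrier := by
  obtain ⟨n, rfl⟩ := Nat.exists_eq_succ_of_ne_zero hn
  rw [Nat.succ_eq_add_one, succ_nsmul] at h
  exact ((F.add_mem_iff _ (Q.nsmul_mem ha n) _ ha).1 h).2

theorem mem_closure_iff (F : Face Q) {x : Fin N → ℤ} :
    x ∈ AddSubgroup.closure F.carrier ↔ ∃ a ∈ F.carrier, ∃ b ∈ F.carrier, x = a - b := by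
  constructor
  · intro h
    induction h using AddSubgroup.closure_induction with
    | mem x hx => exact ⟨x, hx, 0, F.zero_mem, by simp⟩
    | zero => exact ⟨0, F.zero_mem, 0, F.zero_mem, by simp⟩
    | add x y _ _ hx hy =>
      obtain ⟨a, ha, b, hb, rfl⟩ := hx
      obtain ⟨c, hc, d, hd, rfl⟩ := hy
      exact ⟨a + c, F.add_mem ha hc, b + d, F.add_mem hb hd, by abel⟩
    | neg x _ hx =>
      obtain ⟨a, ha, b, hb, rfl⟩ := hx
      exact ⟨b, hb, a, ha, by abel⟩
  · rintro ⟨a, ha, b, hb, rfl⟩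
    exact sub_mem (AddSubgroup.subset_closure ha) (AddSubgroup.subset_closure hb)

/-- If `x = a - b` with `a, b ∈ F`, then `x + b` lies in `F`, hence so does its summand `x`. Thus
`gp(F) ∩ Q = F`. -/
theorem mem_of_mem_closure (F : Face Q) {x : Fin N → ℤ} (hx : x ∈ Q)
    (h : x ∈ AddSubgroup.closure F.carrier) : x ∈ F.carrier := by
  obtain ⟨a, ha, b, hb, rfl⟩ := F.mem_closure_iff.1 h
  exact ((F.add_mem_iff _ hx _ (F.subset hb)).1 (by simpa using ha)).1

theorem mem_translate_iff (F : Face Q) {m x : Fin N → ℤ} :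
    x ∈ F.translate m ↔ x - m ∈ AddSubgroup.closure F.carrier := by
  constructor
  · rintro ⟨f, hf, rfl⟩
    simpa using hf
  · exact fun h => ⟨_, h, by abel⟩

theorem self_mem_translate (F : Face Q) (m : Fin N → ℤ) : m ∈ F.translate m :=
  F.mem_translate_iff.2 (by simp)

theorem add_mem_translate (F : Face Q) {f m x : Fin N → ℤ} (hf : f ∈ F.carrier)
    (hx : x ∈ F.translate m) : f + x ∈ F.translate m := by
  rw [mem_translate_iff] at *
  rw [add_sub_assoc]
  exact AddMemClass.add_mem (AddSubgroup.subset_closure hf) hx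

theorem translate_subset {F G : Face Q} (h : F.carrier ⊆ G.carrier) {m x : Fin N → ℤ}
    (hx : x ∈ G.translate m) : F.translate x ⊆ G.translate m := by
  intro y hy
  rw [mem_translate_iff] at *
  have := AddMemClass.add_mem (AddSubgroup.closure_mono h hy) hx
  simpa using this

theorem translate_eq (F : Face Q) {m x : Fin N → ℤ} (hx : x ∈ F.translate m) :
    F.translate x = F.translate m := by
  refine (translate_subset subset_rfl hx).antisymm (translate_subset subset_rfl ?_)
  rw [mem_translate_iff] at *
  simpa using neg_mem hx

theorem exists_add_eq_of_mem_translate (F : Face Q) {m x : Fin N → ℤ} (hx : x ∈ F.translate m) :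
    ∃ a ∈ F.carrier, ∃ b ∈ F.carrier, a + x = b + m := by
  obtain ⟨b, hb, a, ha, h⟩ := F.mem_closure_iff.1 (F.mem_translate_iff.1 hx)
  exact ⟨a, ha, b, hb, by rw [sub_eq_sub_iff_add_eq_add] at h; rw [add_comm a, h]⟩

/-- A sum lies in a face only if all its summands do, so a face is determined by the generators of
`Q` it contains. -/
theorem subset_of_generators {S : Set (Fin N → ℤ)} (hS : AddSubmonoid.closure S = Q)
    {F G : Face Q} (h : ∀ s ∈ S, s ∈ F.carrier → s ∈ G.carrier) : F.carrier ⊆ G.carrier := by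
  have key : ∀ q ∈ Q, q ∈ F.carrier → q ∈ G.carrier := by
    intro q hq
    subst hS
    induction hq using AddSubmonoid.closure_induction with
    | mem x hx => exact h x hx
    | zero => exact fun _ => G.zero_mem
    | add x y hx hy ihx ihy =>
      intro hxy
      rw [F.add_mem_iff _ hx _ hy] at hxy
      exact G.add_mem (ihx hxy.1) (ihy hxy.2)
  exact fun q hq => key q (F.subset hq) hq

theorem finite (hQ : Q.FG) : Finite (Face Q) := by
  obtain ⟨S, hS⟩ := hQ
  let φ : Face Q → Set S := fun F => {s | s.1 ∈ F.carrier}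
  have aux : ∀ F G : Face Q, φ F = φ G → F.carrier ⊆ G.carrier := fun F G h =>
    subset_of_generators hS fun s hs hF => by
      have : (⟨s, hs⟩ : S) ∈ φ F := hF
      rw [h] at this
      exact this
  exact Finite.of_injective φ fun F G h => Face.ext ((aux F G h).antisymm (aux G F h.symm))

theorem sum_mem (F : Face Q) (T : Finset (Fin N → ℤ)) (f : (Fin N → ℤ) → (Fin N → ℤ))
    (h : ∀ t ∈ T, f t ∈ F.carrier) : ∑ t ∈ T, f t ∈ F.carrier := by
  classical
  induction T using Finset.induction_on with
  | empty => simpa using F.zero_mem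
  | insert a T ha ih =>
    rw [Finset.sum_insert ha]
    exact F.add_mem (h a (by simp)) (ih fun t ht => h t (by simp [ht]))

/-- A face has an element that lies in no smaller face. -/
theorem exists_interior (hQ : Q.FG) (F : Face Q) :
    ∃ f ∈ F.carrier, ∀ H : Face Q, f ∈ H.carrier → F.carrier ⊆ H.carrier := by
  classical
  obtain ⟨S, hS⟩ := hQ
  have hF : ∀ t ∈ S.filter (· ∈ F.carrier), t ∈ F.carrier := fun t ht => (Finset.mem_filter.1 ht).2
  -- The sum of all generators in `F`: a face containing it contains each of them.
  refine ⟨∑ t ∈ S.filter (· ∈ F.carrier), t, F.sum_mem _ _ hF, fun H hH => ?_⟩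
  refine subset_of_generators hS fun s hs hsF => ?_
  have hs' : s ∈ S.filter (· ∈ F.carrier) := by simpa [hsF] using hs
  rw [← Finset.add_sum_erase _ _ hs'] at hH
  exact ((H.add_mem_iff _ (F.subset hsF) _
    (F.subset (F.sum_mem _ _ fun t ht => hF t (Finset.mem_of_mem_erase ht)))).1 hH).1

/-- The smallest face, consisting of the invertible elements of `Q`. -/
def units (Q : AddSubmonoid (Fin N → ℤ)) : Face Q where
  carrier := {q | q ∈ Q ∧ -q ∈ Q}
  nonempty := ⟨0, by simp⟩
  subset _ h := h.1
  add_mem_iff := by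
    refine fun a ha b hb => ⟨fun h => ⟨⟨ha, ?_⟩, hb, ?_⟩, fun h => ⟨Q.add_mem ha hb, ?_⟩⟩
    · have := Q.add_mem h.2 hb
      rwa [neg_add, neg_add_cancel_right] at this
    · have := Q.add_mem h.2 ha
      rwa [add_comm a, neg_add, neg_add_cancel_right] at this
    · rw [neg_add]
      exact Q.add_mem h.1.2 h.2.2

/-- The smallest face that contains the face `F` and the element `q` of `Q`. -/
def adjoin (F : Face Q) (q : Fin N → ℤ) (hq : q ∈ Q) : Face Q where
  carrier := {h | h ∈ Q ∧ ∃ h' ∈ Q, ∃ f ∈ F.carrier, ∃ n : ℕ, h + h' = f + n • q}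
  nonempty := ⟨q, hq, 0, Q.zero_mem, 0, F.zero_mem, 1, by simp⟩
  subset _ h := h.1
  add_mem_iff := by
    refine fun a ha b hb => ⟨?_, ?_⟩
    · rintro ⟨-, h', hh', f, hf, n, h⟩
      exact ⟨⟨ha, b + h', Q.add_mem hb hh', f, hf, n, by rw [← h]; abel⟩,
        ⟨hb, a + h', Q.add_mem ha hh', f, hf, n, by rw [← h]; abel⟩⟩
    · rintro ⟨⟨-, h', hh', f, hf, n, h⟩, -, h'', hh'', f', hf', n', h2⟩
      refine ⟨Q.add_mem ha hb, h' + h'', Q.add_mem hh' hh'', f + f', F.add_mem hf hf', n + n', ?_⟩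
      rw [add_nsmul, add_add_add_comm, h, h2]
      abel

theorem subset_adjoin (F : Face Q) (q : Fin N → ℤ) (hq : q ∈ Q) :
    F.carrier ⊆ (F.adjoin q hq).carrier :=
  fun f hf => ⟨F.subset hf, 0, Q.zero_mem, f, hf, 0, by simp⟩

theorem mem_adjoin (F : Face Q) (q : Fin N → ℤ) (hq : q ∈ Q) : q ∈ (F.adjoin q hq).carrier :=
  ⟨hq, 0, Q.zero_mem, 0, F.zero_mem, 1, by simp⟩

/-- If the translates `gp(F i) + m i`, finitely many, cover `G + n`, then one of them contains
`gp(G) + n`. -/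
theorem exists_subset_of_cover (hQ : Q.FG) {ι : Type*} [Finite ι] (F : ι → Face Q)
    (m : ι → (Fin N → ℤ)) (I : Set ι) (G : Face Q) (n : Fin N → ℤ)
    (h : ∀ g ∈ G.carrier, ∃ i ∈ I, g + n ∈ (F i).translate (m i)) :
    ∃ i ∈ I, G.carrier ⊆ (F i).carrier ∧ n ∈ (F i).translate (m i) := by
  obtain ⟨f, hf, hint⟩ := exists_interior hQ G
  -- Two of the infinitely many points `k • f + n` fall into the same coset. Their difference, a
  -- positive multiple of `f`, lies in the group of that face, so `f` lies in the face, and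
  -- interiority of `f` gives all of `G`.
  choose i hi using fun k : ℕ => h _ (G.nsmul_mem hf k)
  obtain ⟨a, b, hab, heq⟩ := Finite.exists_ne_map_eq_of_infinite i
  wlog hlt : a < b generalizing a b
  · exact this b a hab.symm heq.symm (lt_of_le_of_ne (not_lt.1 hlt) hab.symm)
  have ha := (mem_translate_iff _).1 (hi a).2
  have hb := (mem_translate_iff _).1 (hi b).2
  rw [← heq] at hb
  have hk : (b - a) • f ∈ AddSubgroup.closure (F (i a)).carrier := by
    have := sub_mem hb ha
    rwa [sub_sub_sub_cancel_right, add_sub_add_right_eq_sub, sub_eq_iff_eq_add.2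
      (by rw [← add_nsmul, Nat.sub_add_cancel hlt.le] : b • f = (b - a) • f + a • f)] at this
  have hfF : f ∈ (F (i a)).carrier :=
    mem_of_nsmul_mem _ (G.subset hf) (n := b - a) (by omega)
      (mem_of_mem_closure _ (Q.nsmul_mem (G.subset hf) _) hk)
  refine ⟨i a, (hi a).1, hint _ hfF, (mem_translate_iff _).2 ?_⟩
  have := sub_mem ha (AddSubgroup.subset_closure (nsmul_mem _ hfF a))
  rwa [add_sub_assoc, add_sub_cancel_left] at this

end Face

/-! ### Translates of faces that avoid a submodule -/

/-- The set `G + n` is disjoint from `U`. -/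
def Avoids (U : QModule Q) (G : Face Q) (n : Fin N → ℤ) : Prop :=
  ∀ g ∈ G.carrier, g + n ∉ U.carrier

/-- `G` is a maximal face among those for which `G + n` is disjoint from `U`. -/
def IsMaximalAt (U : QModule Q) (G : Face Q) (n : Fin N → ℤ) : Prop :=
  Avoids U G n ∧ ∀ H : Face Q, G.carrier ⊆ H.carrier → Avoids U H n → H = G

theorem Avoids.mono {U U' : QModule Q} (h : U.carrier ⊆ U'.carrier) {G : Face Q} {n : Fin N → ℤ}
    (hG : Avoids U' G n) : Avoids U G n :=
  fun g hg hU => hG g hg (h hU)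

theorem Avoids.add {U : QModule Q} {G : Face Q} {n g : Fin N → ℤ} (h : Avoids U G n)
    (hg : g ∈ G.carrier) : Avoids U G (g + n) := fun f hf => by
  rw [← add_assoc]
  exact h _ (G.add_mem hf hg)

theorem Avoids.of_add {U : QModule Q} {G : Face Q} {n q : Fin N → ℤ} (hq : q ∈ Q)
    (h : Avoids U G (q + n)) : Avoids U G n := fun f hf hU => h f hf (by
  have := U.add_mem q hq _ hU
  rwa [add_left_comm] at this)

theorem Avoids.notMem {U : QModule Q} {G : Face Q} {n : Fin N → ℤ} (h : Avoids U G n) :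
    n ∉ U.carrier := by
  have := h 0 G.zero_mem
  rwa [zero_add] at this

theorem Avoids.of_mem_translate {U : QModule Q} {G : Face Q} {n m : Fin N → ℤ} (h : Avoids U G m)
    (hn : n ∈ G.translate m) : Avoids U G n := by
  obtain ⟨a, ha, b, hb, hab⟩ := G.exists_add_eq_of_mem_translate hn
  refine Avoids.of_add (G.subset ha) ?_
  rw [hab]
  exact h.add hb

theorem avoids_iff {M U : QModule Q} {G : Face Q} {n : Fin N → ℤ} (hn : n ∈ M.carrier) :
    (∀ g ∈ G.carrier, g + n ∈ M.carrier \ U.carrier) ↔ Avoids U G n :=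
  ⟨fun h g hg => (h g hg).2, fun h g hg => ⟨M.add_mem g (G.subset hg) n hn, h g hg⟩⟩

/-- Translation by an invertible element of `Q` preserves the complement of `U`. Hence every point
outside `U` admits some avoiding face, and so a maximal one. -/
theorem avoids_units {U : QModule Q} {n : Fin N → ℤ} (hn : n ∉ U.carrier) :
    Avoids U (Face.units Q) n := fun g hg hU => hn (by
  have := U.add_mem _ hg.2 _ hU
  rwa [neg_add_cancel_left] at this)

theorem exists_isMaximalAt (hQ : Q.FG) {U : QModule Q} {G : Face Q} {n : Fin N → ℤ}
    (h : Avoids U G n) : ∃ H : Face Q, G.carrier ⊆ H.carrier ∧ IsMaximalAt U H n := by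
  have := Face.finite hQ
  obtain ⟨H, ⟨hGH, hH⟩, hmax⟩ := Set.Finite.exists_maximalFor Face.carrier
    {H : Face Q | G.carrier ⊆ H.carrier ∧ Avoids U H n} (Set.toFinite _) ⟨G, subset_rfl, h⟩
  exact ⟨H, hGH, hH, fun K hK hKn => Face.ext ((hmax ⟨hGH.trans hK, hKn⟩ hK).antisymm hK)⟩

/-- The pairs of a face `G` and a set `gp(G) + n`, where `n ∈ M` and `G` is maximal at `n`. -/
def pieces (M U : QModule Q) : Set (Face Q × Set (Fin N → ℤ)) :=
  {p | ∃ n ∈ M.carrier, IsMaximalAt U p.1 n ∧ p.2 = p.1.translate n}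

/-! ### Existence and uniqueness of irredundant decompositions -/

section Decomposition

variable {M U : QModule Q} {r : ℕ} {F : Fin r → Face Q} {m : Fin r → (Fin N → ℤ)}

namespace IsIrredundantDecomposition

theorem avoids (h : IsIrredundantDecomposition M U F m) {i : Fin r} {n : Fin N → ℤ}
    (hn : n ∈ M.carrier) (hi : n ∈ (F i).translate (m i)) : Avoids U (F i) n := by
  rw [← avoids_iff hn]
  intro g hg
  rw [h.eq_iUnion]
  exact Set.mem_iUnion.2 ⟨i, (F i).add_mem_translate hg hi, M.add_mem g ((F i).subset hg) n hn⟩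

theorem exists_subset (hQ : Q.FG) (h : IsIrredundantDecomposition M U F m) {G : Face Q}
    {n : Fin N → ℤ} (hn : n ∈ M.carrier) (hG : Avoids U G n) :
    ∃ i, G.carrier ⊆ (F i).carrier ∧ n ∈ (F i).translate (m i) := by
  obtain ⟨i, -, hi⟩ := Face.exists_subset_of_cover hQ F m Set.univ G n fun g hg => by
    have := (avoids_iff hn).2 hG g hg
    rw [h.eq_iUnion] at this
    obtain ⟨i, hi⟩ := Set.mem_iUnion.1 this
    exact ⟨i, trivial, hi.1⟩
  exact ⟨i, hi⟩

theorem not_subset (h : IsIrredundantDecomposition M U F m) (j : Fin r) :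
    ¬ (F j).translate (m j) ∩ M.carrier ⊆
      ⋃ i ∈ {i | i ≠ j}, (F i).translate (m i) ∩ M.carrier := by
  intro hj
  refine h.irredundant j ?_
  rw [h.eq_iUnion]
  refine (Set.iUnion_subset fun i => ?_).antisymm
    (Set.iUnion₂_subset fun i _ => Set.subset_iUnion (fun i => (F i).translate (m i) ∩ M.carrier) i)
  by_cases hij : i = j
  · exact hij ▸ hj
  · exact Set.subset_biUnion_of_mem (u := fun i => (F i).translate (m i) ∩ M.carrier) hij

theorem nonempty (h : IsIrredundantDecomposition M U F m) (j : Fin r) :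
    ∃ n ∈ M.carrier, n ∈ (F j).translate (m j) := by
  by_contra! hcon
  exact h.not_subset j fun x hx => absurd hx.1 (hcon x hx.2)

theorem eq_of_translate_subset (h : IsIrredundantDecomposition M U F m) {i j : Fin r}
    (hij : (F j).translate (m j) ⊆ (F i).translate (m i)) : i = j := by
  by_contra hne
  exact h.not_subset j fun x hx => Set.mem_biUnion (x := i) hne ⟨hij hx.1, hx.2⟩

/-- A larger avoiding face would, by the covering lemma, put its whole coset inside some piece `j`.
Piece `i` would then lie in piece `j`, so `j = i` by irredundancy and the two faces agree. -/
theorem isMaximalAt (hQ : Q.FG) (h : IsIrredundantDecomposition M U F m) {i : Fin r}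
    {n : Fin N → ℤ} (hn : n ∈ M.carrier) (hi : n ∈ (F i).translate (m i)) :
    IsMaximalAt U (F i) n := by
  refine ⟨h.avoids hn hi, fun H hH hav => ?_⟩
  obtain ⟨j, hj, hnj⟩ := h.exists_subset hQ hn hav
  have : j = i := h.eq_of_translate_subset (by
    rw [← (F i).translate_eq hi]
    exact Face.translate_subset (hH.trans hj) hnj)
  subst this
  exact Face.ext (hj.antisymm hH)

theorem injective (h : IsIrredundantDecomposition M U F m) :
    Function.Injective fun i => (F i, (F i).translate (m i)) := fun i j hij => by
  simp only [Prod.mk.injEq] at hij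
  exact h.eq_of_translate_subset hij.2.symm.subset

/-- The right-hand side depends only on `M` and `U`; uniqueness, the geometric characterization and
the counting of pieces all rest on this. -/
theorem range_eq (hQ : Q.FG) (h : IsIrredundantDecomposition M U F m) :
    Set.range (fun i => (F i, (F i).translate (m i))) = pieces M U := by
  ext ⟨G, C⟩
  constructor
  · rintro ⟨i, hi⟩
    obtain ⟨rfl, rfl⟩ := Prod.mk.injEq _ _ _ _ ▸ hi
    obtain ⟨n, hn, hi⟩ := h.nonempty i
    exact ⟨n, hn, h.isMaximalAt hQ hn hi, ((F i).translate_eq hi).symm⟩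
  · rintro ⟨n, hn, hmax, hC⟩
    simp only at hmax hC
    subst hC
    obtain ⟨i, hi, hni⟩ := h.exists_subset hQ hn hmax.1
    have : F i = G := hmax.2 _ hi (h.avoids hn hni)
    subst this
    exact ⟨i, by simp only [(F i).translate_eq hni]⟩

theorem exists_equiv (hQ : Q.FG) (h : IsIrredundantDecomposition M U F m) {r' : ℕ}
    {F' : Fin r' → Face Q} {m' : Fin r' → (Fin N → ℤ)}
    (h' : IsIrredundantDecomposition M U F' m') :
    ∃ σ : Fin r ≃ Fin r', ∀ i, F' (σ i) = F i ∧
      (F' (σ i)).translate (m' (σ i)) = (F i).translate (m i) := by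
  refine ⟨((Equiv.ofInjective _ h.injective).trans (Equiv.setCongr
    ((h.range_eq hQ).trans (h'.range_eq hQ).symm))).trans (Equiv.ofInjective _ h'.injective).symm,
    fun i => ?_⟩
  rw [← Prod.mk.injEq]
  exact Equiv.apply_ofInjective_symm h'.injective _

theorem exists_piece_iff (hQ : Q.FG) (h : IsIrredundantDecomposition M U F m) (G : Face Q)
    {n : Fin N → ℤ} (hn : n ∈ M.carrier) :
    (∃ i, F i = G ∧ (F i).translate (m i) = G.translate n) ↔ IsMaximalAt U G n := by
  constructor
  · rintro ⟨i, rfl, hi⟩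
    exact h.isMaximalAt hQ hn (hi ▸ (F i).self_mem_translate n)
  · intro hG
    have : (G, G.translate n) ∈ pieces M U := ⟨n, hn, hG, rfl⟩
    rw [← h.range_eq hQ] at this
    obtain ⟨i, hi⟩ := this
    exact ⟨i, (Prod.mk.injEq _ _ _ _ ▸ hi)⟩

end IsIrredundantDecomposition

theorem exists_decomposition (hQ : Q.FG) (hfin : (pieces M U).Finite) :
    ∃ (r : ℕ) (F : Fin r → Face Q) (m : Fin r → (Fin N → ℤ)),
      IsIrredundantDecomposition M U F m := by
  have := hfin.to_subtype
  obtain ⟨r, ⟨e⟩⟩ := Finite.exists_equiv_fin (pieces M U)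
  choose m hm hmax htr using fun i => (e.symm i).2
  have hav : ∀ i x, x ∈ M.carrier → x ∈ (e.symm i).1.1.translate (m i) →
      Avoids U (e.symm i).1.1 x := fun i x hx hxi => (hmax i).1.of_mem_translate hxi
  refine ⟨r, fun i => (e.symm i).1.1, m, fun i => M.subset_gp _ (hm i), ?_, fun j hj => ?_⟩
  · ext x
    rw [Set.mem_iUnion]
    constructor
    · rintro ⟨hxM, hxU⟩
      obtain ⟨H, -, hH⟩ := exists_isMaximalAt hQ (avoids_units hxU)
      let p : pieces M U := ⟨(H, H.translate x), x, hxM, hH, rfl⟩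
      refine ⟨e p, ?_, hxM⟩
      rw [← htr, e.symm_apply_apply]
      exact H.self_mem_translate x
    · rintro ⟨i, hxi, hxM⟩
      exact ⟨hxM, (hav i x hxM hxi).notMem⟩
  -- If piece `j` were superfluous, the covering lemma would yield another piece through `m j` with
  -- a larger face. Maximality at `m j` makes the faces, hence the cosets, equal, although the
  -- pieces are enumerated without repetition.
  · obtain ⟨i, hij, hsub, hmem⟩ := Face.exists_subset_of_cover hQ (fun i => (e.symm i).1.1) m
      {i | i ≠ j} (e.symm j).1.1 (m j) fun g hg => by
        have := (avoids_iff (hm j)).2 (hmax j).1 g hg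
        rw [hj] at this
        obtain ⟨i, hij, hi⟩ := Set.mem_iUnion₂.1 this
        exact ⟨i, hij, hi.1⟩
    refine hij (e.symm.injective (Subtype.ext ?_))
    have h1 := (hmax j).2 _ hsub (hav i _ (hm j) hmem)
    refine Prod.ext h1 ?_
    rw [htr, htr, ← Face.translate_eq _ hmem, h1]

end Decomposition

/-! ### Reduction to the primary part -/

/-- The translates `gp(G) + n` with `n ∈ M` and `G` maximal at `n`. -/
def maximalCosets (G : Face Q) (M U : QModule Q) : Set (Set (Fin N → ℤ)) :=
  {C | ∃ n ∈ M.carrier, IsMaximalAt U G n ∧ C = G.translate n}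

/-- The translates `gp(G) + n` with `n ∈ M` and `G + n` disjoint from `U`. -/
def avoidingCosets (G : Face Q) (M U : QModule Q) : Set (Set (Fin N → ℤ)) :=
  {C | ∃ n ∈ M.carrier, Avoids U G n ∧ C = G.translate n}

theorem IsIrredundantDecomposition.encard_eq (hQ : Q.FG) {M U : QModule Q} {r : ℕ}
    {F : Fin r → Face Q} {m : Fin r → (Fin N → ℤ)} (h : IsIrredundantDecomposition M U F m)
    (G : Face Q) : {i | F i = G}.encard = (maximalCosets G M U).encard := by
  have : maximalCosets G M U = (fun i => (F i).translate (m i)) '' {i | F i = G} := by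
    ext C
    have := Set.ext_iff.1 (h.range_eq hQ) (G, C)
    refine Iff.trans this.symm ?_
    simp only [Set.mem_range, Prod.mk.injEq, Set.mem_image, Set.mem_ofPred_eq]
  rw [this, Set.InjOn.encard_image]
  rintro i (hi : F i = G) j (hj : F j = G) hij
  exact h.injective (Prod.ext (hi.trans hj.symm) hij)

theorem finite_pieces (hQ : Q.FG) {M U : QModule Q} (h : ∀ G, (maximalCosets G M U).Finite) :
    (pieces M U).Finite := by
  have := Face.finite hQ
  refine (Set.finite_iUnion fun G => (h G).image (Prod.mk G)).subset ?_
  rintro ⟨G, C⟩ ⟨n, hn, hG, hC⟩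
  exact Set.mem_iUnion.2 ⟨G, C, ⟨n, hn, hG, hC⟩, rfl⟩

/-- The elements of `M` that are moved into `U` by a multiple of each element of `Q ∖ G`. -/
def primaryPart (M U : QModule Q) (G : Face Q) : QModule Q where
  carrier := {m | m ∈ M.carrier ∧ ∀ q ∈ Q, q ∉ G.carrier → ∃ n : ℕ, n • q + m ∈ U.carrier}
  subset_gp m hm := M.subset_gp m hm.1
  add_mem p hp m hm := ⟨M.add_mem p hp m hm.1, fun q hq hG => by
    obtain ⟨n, hn⟩ := hm.2 q hq hG
    exact ⟨n, by rw [add_left_comm]; exact U.add_mem p hp _ hn⟩⟩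

theorem primaryPart_subset (M U : QModule Q) (G : Face Q) :
    (primaryPart M U G).carrier ⊆ M.carrier := fun _ h => h.1

theorem subset_primaryPart {M U : QModule Q} (h : U.carrier ⊆ M.carrier) (G : Face Q) :
    U.carrier ⊆ (primaryPart M U G).carrier :=
  fun _ hu => ⟨h hu, fun _ _ _ => ⟨0, by simpa using hu⟩⟩

theorem isMaximalAt_of_mem_primaryPart {M U : QModule Q} {G : Face Q} {n : Fin N → ℤ}
    (hn : n ∈ (primaryPart M U G).carrier) (h : Avoids U G n) : IsMaximalAt U G n := by
  refine ⟨h, fun H hH hav => Face.ext (Set.Subset.antisymm (fun q hq => ?_) hH)⟩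
  by_contra hqG
  obtain ⟨k, hk⟩ := hn.2 q (H.subset hq) hqG
  exact hav _ (H.nsmul_mem hq k) hk

/-- Maximality says that for each generator `s ∉ G` the face spanned by `G` and `s` hits `U`; after
a shift by some `g s ∈ G`, a multiple of `s` itself does. Adding up the shifts over the finitely
many generators serves all of them at once. -/
theorem IsMaximalAt.exists_add_mem_primaryPart (hQ : Q.FG) {M U : QModule Q} {G : Face Q}
    {n : Fin N → ℤ} (hn : n ∈ M.carrier) (h : IsMaximalAt U G n) :
    ∃ g ∈ G.carrier, g + n ∈ (primaryPart M U G).carrier := by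
  classical
  obtain ⟨S, hS⟩ := hQ
  have key : ∀ s : Fin N → ℤ, ∃ g ∈ G.carrier, s ∈ Q → s ∉ G.carrier →
      ∃ k : ℕ, k • s + (g + n) ∈ U.carrier := by
    intro s
    by_cases hs : s ∈ Q ∧ s ∉ G.carrier
    · have hav : ¬ Avoids U (G.adjoin s hs.1) n := fun hav => hs.2
        (h.2 _ (G.subset_adjoin s hs.1) hav ▸ G.mem_adjoin s hs.1)
      simp only [Avoids, not_forall, not_not] at hav
      -- Here `a + n ∈ U` and `a + b = g + k • s`, so adding `b` gives `k • s + (g + n) ∈ U`.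
      obtain ⟨a, ⟨-, b, hb, g, hg, k, hab⟩, haU⟩ := hav
      refine ⟨g, hg, fun _ _ => ⟨k, ?_⟩⟩
      have := U.add_mem b hb _ haU
      rwa [← add_assoc, add_comm b, hab, add_comm g, add_assoc] at this
    · exact ⟨0, G.zero_mem, fun h1 h2 => absurd ⟨h1, h2⟩ hs⟩
  choose g hg hk using key
  have hsum := G.sum_mem S g fun t _ => hg t
  refine ⟨∑ s ∈ S, g s, hsum, M.add_mem _ (G.subset hsum) _ hn, fun q hq => ?_⟩
  rw [← or_iff_not_imp_left]
  have hgen : ∀ s ∈ S, s ∉ G.carrier → ∃ k : ℕ, k • s + (∑ s ∈ S, g s + n) ∈ U.carrier := by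
    intro s hs hsG
    obtain ⟨k, hk⟩ := hk s (hS ▸ AddSubmonoid.subset_closure hs) hsG
    refine ⟨k, ?_⟩
    rw [← Finset.add_sum_erase _ _ hs]
    have := U.add_mem _ (G.subset (G.sum_mem (S.erase s) g fun t _ => hg t)) _ hk
    convert this using 1
    abel
  rw [← hS] at hq
  induction hq using AddSubmonoid.closure_induction with
  | mem s hs => exact or_iff_not_imp_left.2 (hgen s hs)
  | zero => exact Or.inl G.zero_mem
  | add a b ha hb iha ihb =>
    rw [hS] at ha hb
    rcases iha with iha | ⟨k, hk⟩
    · rcases ihb with ihb | ⟨k, hk⟩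
      · exact Or.inl (G.add_mem iha ihb)
      · refine Or.inr ⟨k, ?_⟩
        rw [nsmul_add, add_assoc]
        exact U.add_mem _ (Q.nsmul_mem ha k) _ hk
    · refine Or.inr ⟨k, ?_⟩
      rw [add_comm a, nsmul_add, add_assoc]
      exact U.add_mem _ (Q.nsmul_mem hb k) _ hk

/-- Inside the primary part avoidance already implies maximality. Conversely, a point where `G` is
maximal moves into the primary part without leaving its coset. -/
theorem maximalCosets_eq (hQ : Q.FG) (M U : QModule Q) (G : Face Q) :
    maximalCosets G M U = avoidingCosets G (primaryPart M U G) U := by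
  ext C
  constructor
  · rintro ⟨n, hn, hmax, rfl⟩
    obtain ⟨g, hg, hgn⟩ := hmax.exists_add_mem_primaryPart hQ hn
    exact ⟨g + n, hgn, hmax.1.add hg,
      (G.translate_eq (G.add_mem_translate hg (G.self_mem_translate n))).symm⟩
  · rintro ⟨n, hn, hav, rfl⟩
    exact ⟨n, hn.1, isMaximalAt_of_mem_primaryPart hn hav, rfl⟩

/-! ### Elementary extensions and how they change the set of avoiding cosets -/

/-- `U'` is the disjoint union of `U` and `G + m`. -/
structure IsElementaryExtension (U U' : QModule Q) (G : Face Q) (m : Fin N → ℤ) : Prop where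
  carrier_eq : U'.carrier = U.carrier ∪ {x | ∃ g ∈ G.carrier, x = g + m}
  avoids : Avoids U G m

namespace IsElementaryExtension

variable {U U' M : QModule Q} {G : Face Q} {m : Fin N → ℤ}

theorem subset (h : IsElementaryExtension U U' G m) : U.carrier ⊆ U'.carrier := by
  rw [h.carrier_eq]
  exact Set.subset_union_left

theorem add_mem (h : IsElementaryExtension U U' G m) {g : Fin N → ℤ} (hg : g ∈ G.carrier) :
    g + m ∈ U'.carrier := by
  rw [h.carrier_eq]
  exact Or.inr ⟨g, hg, rfl⟩

theorem mem (h : IsElementaryExtension U U' G m) : m ∈ U'.carrier := by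
  simpa using h.add_mem G.zero_mem

theorem add_mem_of_notMem (h : IsElementaryExtension U U' G m) {q : Fin N → ℤ} (hq : q ∈ Q)
    (hqG : q ∉ G.carrier) : q + m ∈ U.carrier := by
  have := U'.add_mem q hq m h.mem
  rw [h.carrier_eq] at this
  refine this.resolve_right ?_
  rintro ⟨g, hg, hgm⟩
  exact hqG (add_right_cancel hgm ▸ hg)

/-- Passing from `U'` to `U`, the set of avoiding translates gains at most `gp(G) + m`. -/
theorem avoidingCosets_subset (h : IsElementaryExtension U U' G m) {F : Face Q}
    (hm : ∀ q ∈ Q, q ∉ F.carrier → ∃ n : ℕ, n • q + m ∈ U.carrier)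
    {n : Fin N → ℤ} (hn : n ∈ M.carrier) (hav : Avoids U F n)
    (hnot : F.translate n ∉ avoidingCosets F M U') : F = G ∧ F.translate n = F.translate m := by
  -- Each `F + (f + n)` avoids `U` but not `U'`, so it meets `G + m`. Comparing the meeting points
  -- for `f` and `q + f` puts `q` into `G`.
  have hmeet : ∀ f ∈ F.carrier, ∃ f' ∈ F.carrier, ∃ g ∈ G.carrier, f' + (f + n) = g + m := by
    intro f hf
    by_contra! hcon
    refine hnot ⟨f + n, M.add_mem f (F.subset hf) n hn, fun f' hf' hU' => ?_,
      (F.translate_eq (F.add_mem_translate hf (F.self_mem_translate n))).symm⟩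
    rw [h.carrier_eq] at hU'
    rcases hU' with hU' | ⟨g, hg, heq⟩
    · exact hav.add hf f' hf' hU'
    · exact hcon f' hf' g hg heq
  obtain ⟨f, hf, g, hg, hfg⟩ := hmeet 0 F.zero_mem
  rw [zero_add] at hfg
  have hFG : F.carrier ⊆ G.carrier := by
    intro q hq
    obtain ⟨f', hf', g', hg', hfg'⟩ := hmeet (q + f) (F.add_mem hq hf)
    have : q + f' ∈ AddSubgroup.closure G.carrier := by
      have h3 : q + f' = g' - g := by
        have : q + f' + (f + n) = g' + m := by rw [← hfg']; abel
        rw [hfg] at this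
        rw [eq_sub_iff_add_eq]
        exact add_right_cancel (b := m) (by rw [add_assoc, this])
      exact h3 ▸ sub_mem (AddSubgroup.subset_closure hg') (AddSubgroup.subset_closure hg)
    have h2 := G.mem_of_mem_closure (Q.add_mem (F.subset hq) (F.subset hf')) this
    exact ((G.add_mem_iff _ (F.subset hq) _ (F.subset hf')).1 h2).1
  -- Multiples of an element outside `F` carry `m` into `U`, whereas `G + m` avoids `U`.
  have hGF : G.carrier ⊆ F.carrier := by
    intro q hq
    by_contra hqF
    obtain ⟨k, hk⟩ := hm q (G.subset hq) hqF
    exact h.avoids _ (G.nsmul_mem hq k) hk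
  obtain rfl : F = G := Face.ext (hFG.antisymm hGF)
  refine ⟨rfl, ?_⟩
  rw [← F.translate_eq (F.add_mem_translate hf (F.self_mem_translate n)), hfg,
    F.translate_eq (F.add_mem_translate hg (F.self_mem_translate m))]

theorem avoidingCosets_mono (h : IsElementaryExtension U U' G m) (F : Face Q) :
    avoidingCosets F M U' ⊆ avoidingCosets F M U := by
  rintro C ⟨n, hn, hav, rfl⟩
  exact ⟨n, hn, hav.mono h.subset, rfl⟩

theorem avoidingCosets_of_ne (h : IsElementaryExtension U U' G m) {F : Face Q}
    (hm : ∀ q ∈ Q, q ∉ F.carrier → ∃ n : ℕ, n • q + m ∈ U.carrier) (hFG : F ≠ G) :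
    avoidingCosets F M U = avoidingCosets F M U' := by
  refine Set.Subset.antisymm ?_ (h.avoidingCosets_mono F)
  rintro C ⟨n, hn, hav, rfl⟩
  by_contra hnot
  exact hFG (h.avoidingCosets_subset hm hn hav hnot).1

theorem avoidingCosets_self (h : IsElementaryExtension U U' G m) (hmM : m ∈ M.carrier)
    (hm : ∀ q ∈ Q, q ∉ G.carrier → ∃ n : ℕ, n • q + m ∈ U.carrier) :
    avoidingCosets G M U = insert (G.translate m) (avoidingCosets G M U') ∧
      G.translate m ∉ avoidingCosets G M U' := by
  refine ⟨Set.Subset.antisymm ?_ (Set.insert_subset ⟨m, hmM, h.avoids, rfl⟩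
    (h.avoidingCosets_mono G)), ?_⟩
  · rintro C ⟨n, hn, hav, rfl⟩
    by_contra hnot
    simp only [Set.mem_insert_iff, not_or] at hnot
    exact hnot.1 (h.avoidingCosets_subset hm hn hav hnot.2).2
  · rintro ⟨n, hn, hav, heq⟩
    have hnm : n ∈ G.translate m := heq ▸ G.self_mem_translate n
    obtain ⟨a, ha, b, hb, hab⟩ := G.exists_add_eq_of_mem_translate hnm
    exact hav a ha (hab ▸ h.add_mem hb)

end IsElementaryExtension

/-! ### Noetherian induction -/

/-- Every ascending chain of submodules of `M` becomes stationary. -/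
def QModule.AscendingChainCondition (M : QModule Q) : Prop :=
  WellFounded fun U V : {U : QModule Q // U.carrier ⊆ M.carrier} => V.1.carrier ⊂ U.1.carrier

/-- The ideal of the elements of `Q` that move `m` into `U`. -/
def QModule.annihilator (U : QModule Q) (m : Fin N → ℤ) : QModule Q where
  carrier := {q | q ∈ Q ∧ q + m ∈ U.carrier}
  subset_gp _ hq := AddSubgroup.subset_closure hq.1
  add_mem p hp q hq := ⟨Q.add_mem hp hq.1, by rw [add_assoc]; exact U.add_mem p hp _ hq.2⟩

theorem QModule.annihilator_mono (U : QModule Q) {q : Fin N → ℤ} (hq : q ∈ Q) (m : Fin N → ℤ) :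
    (U.annihilator m).carrier ⊆ (U.annihilator (q + m)).carrier :=
  fun p hp => ⟨hp.1, by rw [add_left_comm]; exact U.add_mem q hq _ hp.2⟩

/-- In a nonempty set there is an element whose annihilator is maximal. -/
theorem exists_maximal_annihilator (hself : (QModule.self Q).AscendingChainCondition)
    (U : QModule Q) {X : Set (Fin N → ℤ)} (hX : X.Nonempty) :
    ∃ x ∈ X, ∀ y ∈ X, (U.annihilator x).carrier ⊆ (U.annihilator y).carrier →
      (U.annihilator y).carrier ⊆ (U.annihilator x).carrier := by
  let φ : (Fin N → ℤ) → {V : QModule Q // V.carrier ⊆ (QModule.self Q).carrier} :=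
    fun x => ⟨U.annihilator x, fun _ hq => hq.1⟩
  obtain ⟨-, ⟨x, hx, rfl⟩, hmin⟩ := hself.has_min (φ '' X) (hX.image φ)
  refine ⟨x, hx, fun y hy hxy => ?_⟩
  by_contra hcon
  exact hmin _ ⟨y, hy, rfl⟩ ⟨hxy, hcon⟩

/-- The combinatorial form of the fact that a maximal annihilator is prime: for `m ∈ M ∖ U` with
maximal annihilator, the elements of `Q` that do not move `m` into `U` form a face. -/
theorem exists_elementaryExtension (hself : (QModule.self Q).AscendingChainCondition)
    {M U : QModule Q} (hUM : U.carrier ⊂ M.carrier) :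
    ∃ (U' : QModule Q) (G : Face Q) (m : Fin N → ℤ), U'.carrier ⊆ M.carrier ∧ m ∈ M.carrier ∧
      IsElementaryExtension U U' G m := by
  obtain ⟨m, ⟨hmM, hmU⟩, hmax⟩ := exists_maximal_annihilator hself U
    (Set.nonempty_of_ssubset hUM)
  let G : Face Q :=
    { carrier := {q | q ∈ Q ∧ q + m ∉ U.carrier}
      nonempty := ⟨0, Q.zero_mem, by simpa using hmU⟩
      subset := fun _ h => h.1
      add_mem_iff := by
        refine fun a ha b hb => ⟨fun h => ⟨⟨ha, fun hU => h.2 ?_⟩, hb, fun hU => h.2 ?_⟩,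
          fun h => ⟨Q.add_mem ha hb, fun hU => h.1.2 ?_⟩⟩
        · rw [add_comm a, add_assoc]
          exact U.add_mem b hb _ hU
        · rw [add_assoc]
          exact U.add_mem a ha _ hU
        · rw [add_assoc] at hU
          -- `a` annihilates `b + m ∉ U`, whose annihilator contains that of `m` and hence equals
          -- it.
          exact (hmax (b + m) ⟨M.add_mem b hb m hmM, h.2.2⟩ (U.annihilator_mono hb m)
            ⟨ha, hU⟩).2 }
  let U' : QModule Q :=
    { carrier := U.carrier ∪ {x | ∃ g ∈ G.carrier, x = g + m}
      subset_gp := by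
        rintro x (hx | ⟨g, hg, rfl⟩)
        · exact U.subset_gp x hx
        · exact M.subset_gp _ (M.add_mem g hg.1 m hmM)
      add_mem := by
        rintro q hq x (hx | ⟨g, hg, rfl⟩)
        · exact Or.inl (U.add_mem q hq x hx)
        · by_cases h : q + (g + m) ∈ U.carrier
          · exact Or.inl h
          · refine Or.inr ⟨q + g, ⟨Q.add_mem hq hg.1, ?_⟩, ?_⟩
            · rwa [add_assoc]
            · rw [add_assoc] }
  refine ⟨U', G, m, ?_, hmM, rfl, fun g hg => hg.2⟩
  rintro x (hx | ⟨g, hg, rfl⟩)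
  · exact hUM.subset hx
  · exact M.add_mem g hg.1 m hmM

/-- Noetherian induction along elementary extensions. -/
theorem QModule.extension_induction (hself : (QModule.self Q).AscendingChainCondition)
    {M : QModule Q} (hM : M.AscendingChainCondition) {P : QModule Q → Prop} (top : P M)
    (step : ∀ (U U' : QModule Q) (G : Face Q) (m : Fin N → ℤ), U'.carrier ⊆ M.carrier →
      m ∈ M.carrier → IsElementaryExtension U U' G m → P U' → P U)
    (U : QModule Q) (hU : U.carrier ⊆ M.carrier) : P U := by
  have key : ∀ V : {U : QModule Q // U.carrier ⊆ M.carrier}, P V.1 := by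
    intro V
    induction V using hM.induction with
    | _ V ih =>
      by_cases hVM : V.1.carrier = M.carrier
      · rwa [QModule.ext hVM]
      · obtain ⟨U', G, m, hU', hm, hext⟩ :=
          exists_elementaryExtension hself (V.2.ssubset_of_ne hVM)
        exact step _ U' G m hU' hm hext (ih ⟨U', hU'⟩
          ⟨hext.subset, fun hsub => hext.avoids.notMem (hsub hext.mem)⟩)
  exact key ⟨U, hU⟩

theorem finite_avoidingCosets (hself : (QModule.self Q).AscendingChainCondition) {M : QModule Q}
    (hM : M.AscendingChainCondition) (F : Face Q) {U : QModule Q} (hU : U.carrier ⊆ M.carrier)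
    (hprim : ∀ m ∈ M.carrier, ∀ q ∈ Q, q ∉ F.carrier → ∃ n : ℕ, n • q + m ∈ U.carrier) :
    (avoidingCosets F M U).Finite := by
  revert hprim
  refine QModule.extension_induction hself hM
    (P := fun U => (∀ m ∈ M.carrier, ∀ q ∈ Q, q ∉ F.carrier → ∃ n : ℕ, n • q + m ∈ U.carrier) →
      (avoidingCosets F M U).Finite) ?_ ?_ U hU
  · intro _
    convert Set.finite_empty
    refine Set.eq_empty_of_forall_notMem ?_
    rintro C ⟨n, hn, hav, -⟩
    exact hav.notMem hn
  · intro U U' G m hU' hm hext ih hprim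
    have hfin := ih fun x hx q hq hqF => (hprim x hx q hq hqF).imp fun _ h => hext.subset h
    by_cases hFG : F = G
    · subst hFG
      rw [(hext.avoidingCosets_self hm (hprim m hm)).1]
      exact hfin.insert _
    · rwa [hext.avoidingCosets_of_ne (hprim m hm) hFG]

/-- Such an `x` makes the annihilator of the class of `x^x` exactly `p_G`. It is found with maximal
annihilator among the points of the primary part at which `G` avoids `U`. -/
theorem IsMaximalAt.exists_annihilator_eq (hself : (QModule.self Q).AscendingChainCondition)
    (hQ : Q.FG) {M U : QModule Q} {G : Face Q} {n : Fin N → ℤ} (hn : n ∈ M.carrier)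
    (h : IsMaximalAt U G n) :
    ∃ x ∈ M.carrier, ∀ q ∈ Q, q + x ∈ U.carrier ↔ q ∉ G.carrier := by
  obtain ⟨g, hg, hgn⟩ := h.exists_add_mem_primaryPart hQ hn
  obtain ⟨x, ⟨hx, hxav⟩, hmax⟩ := exists_maximal_annihilator hself U
    (X := {x | x ∈ (primaryPart M U G).carrier ∧ Avoids U G x}) ⟨g + n, hgn, h.1.add hg⟩
  refine ⟨x, hx.1, fun q hq => ⟨fun hqx hqG => hxav q hqG hqx, fun hqG => ?_⟩⟩
  obtain ⟨k, hk⟩ := hx.2 q hq hqG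
  classical
  -- At the last `k` before avoidance first fails, some `f + q` with `f ∈ G` annihilates `k • q +
  -- x`, hence `x` by maximality. So `q` annihilates `f + x`, and by maximality again `x`.
  have hex : ∃ k : ℕ, ¬ Avoids U G (k • q + x) := ⟨k, fun hav => hav.notMem hk⟩
  obtain ⟨k, hk⟩ : ∃ k, Nat.find hex = k + 1 := by
    refine Nat.exists_eq_succ_of_ne_zero fun h0 => ?_
    have := Nat.find_spec hex
    rw [h0, zero_nsmul, zero_add] at this
    exact this hxav
  have hk1 := Nat.find_spec hex
  have hk2 : Avoids U G (k • q + x) := not_not.1 (Nat.find_min hex (by omega))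
  rw [hk] at hk1
  simp only [Avoids, not_forall, not_not] at hk1
  obtain ⟨f, hf, hfU⟩ := hk1
  have hkQ := Q.nsmul_mem hq k
  have h1 := hmax _ ⟨(primaryPart M U G).add_mem _ hkQ _ hx, hk2⟩ (U.annihilator_mono hkQ x)
    (show f + q ∈ _ from ⟨Q.add_mem (G.subset hf) hq, by
      rw [succ_nsmul] at hfU
      convert hfU using 1
      abel⟩)
  have h2 := hmax _ ⟨(primaryPart M U G).add_mem _ (G.subset hf) _ hx, hxav.add hf⟩
    (U.annihilator_mono (G.subset hf) x) (show q ∈ _ from ⟨hq, by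
      have := h1.2
      convert this using 1
      abel⟩)
  exact h2.2

end Combinatorics


/-! ### Power torsion and localized length -/

section Length

variable {R : Type*} [CommRing R]

theorem mem_powerTorsion_span_iff {K : Type*} [AddCommGroup K] [Module R K]
    {S : Set R} (hS : (Ideal.span S).FG) {x : K} :
    x ∈ (powerTorsion (Ideal.span S) : Submodule R K) ↔ ∀ s ∈ S, ∃ n : ℕ, s ^ n • x = 0 := by
  constructor
  · rintro ⟨n, hn⟩ s hs
    exact ⟨n, hn _ (Ideal.pow_mem_pow (Ideal.subset_span hs) n)⟩
  · intro h
    have hle : Ideal.span S ≤ (Ideal.torsionOf R K x).radical :=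
      Ideal.span_le.2 fun s hs => (h s hs).imp fun n hn => (Ideal.mem_torsionOf_iff x _).2 hn
    obtain ⟨n, hn⟩ := Ideal.exists_pow_le_of_le_radical_of_fg hle hS
    exact ⟨n, fun a ha => (Ideal.mem_torsionOf_iff x _).1 (hn ha)⟩

/-- The length over `R_p` of the localization of a module at a prime `p`. -/
noncomputable def localizedLength (p : Ideal R) [p.IsPrime] (K : Type*) [AddCommGroup K]
    [Module R K] : ℕ∞ :=
  Module.length (Localization.AtPrime p) (LocalizedModule p.primeCompl K)

variable (p : Ideal R) [p.IsPrime] {K L P : Type*} [AddCommGroup K] [Module R K]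
  [AddCommGroup L] [Module R L] [AddCommGroup P] [Module R P]

theorem localizedLength_add (f : K →ₗ[R] L) (g : L →ₗ[R] P) (hf : Function.Injective f)
    (hg : Function.Surjective g) (hfg : Function.Exact f g) :
    localizedLength p L = localizedLength p K + localizedLength p P :=
  Module.length_eq_add_of_exact (LocalizedModule.map p.primeCompl f)
    (LocalizedModule.map p.primeCompl g) (LocalizedModule.map_injective _ f hf)
    (LocalizedModule.map_surjective _ g hg) (LocalizedModule.map_exact _ f g hfg)

theorem localizedLength_congr (e : K ≃ₗ[R] L) : localizedLength p K = localizedLength p L :=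
  LinearEquiv.length_eq (LinearEquiv.ofBijective (LocalizedModule.map p.primeCompl e.toLinearMap)
    ⟨LocalizedModule.map_injective _ _ e.injective,
      LocalizedModule.map_surjective _ _ e.surjective⟩)

theorem localizedLength_eq_zero {r : R} (hr : r ∉ p) (h : ∀ x : K, r • x = 0) :
    localizedLength p K = 0 := by
  have : Subsingleton (LocalizedModule p.primeCompl K) := by
    refine subsingleton_of_forall_eq 0 fun y => ?_
    induction y using LocalizedModule.induction_on with
    | _ x s =>
      rw [← LocalizedModule.zero_mk 1, LocalizedModule.mk_eq]
      refine ⟨⟨r, hr⟩, ?_⟩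
      rw [one_smul, smul_zero, smul_zero]
      exact h x
  exact Module.length_eq_zero

theorem localizedLength_quotient_self : localizedLength p (R ⧸ p) = 1 := by
  refine Module.length_eq_one_iff.2 (isSimpleModule_iff_toSpanSingleton_surjective.2 ⟨?_, ?_⟩)
  · refine ⟨LocalizedModule.mk (Ideal.Quotient.mk p 1) 1, 0, fun h => ?_⟩
    rw [← LocalizedModule.zero_mk 1, LocalizedModule.mk_eq] at h
    obtain ⟨u, hu⟩ := h
    rw [one_smul, one_smul, smul_zero] at hu
    have hu' : Ideal.Quotient.mk p (u.1 * 1) = 0 := hu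
    rw [mul_one, Ideal.Quotient.eq_zero_iff_mem] at hu'
    exact u.2 hu'
  · intro x hx y
    induction x using LocalizedModule.induction_on with
    | _ x s =>
      induction y using LocalizedModule.induction_on with
      | _ y t =>
        obtain ⟨a, rfl⟩ := Ideal.Quotient.mk_surjective x
        obtain ⟨b, rfl⟩ := Ideal.Quotient.mk_surjective y
        have ha : a ∉ p := fun ha => hx (by
          rw [Ideal.Quotient.eq_zero_iff_mem.2 ha, LocalizedModule.zero_mk])
        -- The quotient of `b/t` by `a/s`, legitimate since `a ∉ p`.
        refine ⟨Localization.mk (s.1 * b) (⟨a, ha⟩ * t), ?_⟩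
        rw [LinearMap.toSpanSingleton_apply, LocalizedModule.mk_smul_mk, LocalizedModule.mk_eq]
        refine ⟨1, ?_⟩
        simp only [one_smul, Submonoid.smul_def, Submonoid.coe_mul]
        change Ideal.Quotient.mk p (t.1 * (s.1 * b * a)) =
          Ideal.Quotient.mk p (a * t.1 * s.1 * b)
        congr 1
        ring

theorem mem_submoduleOf_iff {X : Type*} [AddCommGroup X] [Module R X] {A B : Submodule R X}
    {x : B} : x ∈ A.submoduleOf B ↔ x.1 ∈ A :=
  Iff.rfl

/-- Additivity of the localized length for `A ≤ B ≤ C`. -/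
theorem localizedLength_submoduleOf {X : Type*} [AddCommGroup X] [Module R X]
    {A B C : Submodule R X} (hAB : A ≤ B) (hBC : B ≤ C) :
    localizedLength p (C ⧸ A.submoduleOf C) =
      localizedLength p (B ⧸ A.submoduleOf B) + localizedLength p (C ⧸ B.submoduleOf C) := by
  refine localizedLength_add p
    (Submodule.mapQ (A.submoduleOf B) (A.submoduleOf C) (Submodule.inclusion hBC)
      fun x hx => Submodule.mem_comap.2 (mem_submoduleOf_iff.2 (mem_submoduleOf_iff.1 hx)))
    (Submodule.mapQ (A.submoduleOf C) (B.submoduleOf C) LinearMap.id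
      fun x hx => Submodule.mem_comap.2 (mem_submoduleOf_iff.2 (hAB (mem_submoduleOf_iff.1 hx))))
    ?_ ?_ ?_
  · rw [← LinearMap.ker_eq_bot, LinearMap.ker_eq_bot']
    intro x hx
    obtain ⟨x, rfl⟩ := Submodule.Quotient.mk_surjective _ x
    rw [Submodule.mapQ_apply, Submodule.Quotient.mk_eq_zero] at hx
    rw [Submodule.Quotient.mk_eq_zero]
    exact hx
  · intro x
    obtain ⟨x, rfl⟩ := Submodule.Quotient.mk_surjective _ x
    exact ⟨Submodule.Quotient.mk x, rfl⟩
  · intro x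
    obtain ⟨x, rfl⟩ := Submodule.Quotient.mk_surjective _ x
    rw [Submodule.mapQ_apply, Submodule.Quotient.mk_eq_zero]
    constructor
    · intro hx
      exact ⟨Submodule.Quotient.mk ⟨x.1, hx⟩, rfl⟩
    · rintro ⟨y, hy⟩
      obtain ⟨y, rfl⟩ := Submodule.Quotient.mk_surjective _ y
      rw [Submodule.mapQ_apply, Submodule.Quotient.eq] at hy
      have h1 : y.1 - x.1 ∈ A := hy
      have h2 := B.sub_mem y.2 (hAB h1)
      rwa [sub_sub_cancel] at h2

end Length

/-! ### Monomial modules: multiplicities and associated primes -/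

section Linearization

variable {N : ℕ} {Q : AddSubmonoid (Fin N → ℤ)} (k : Type*) [Field k]

theorem isNoetherianRing_of_fg (hQ : Q.FG) : IsNoetherianRing (AddMonoidAlgebra k Q) := by
  have : AddMonoid.FG Q := (AddMonoid.fg_iff_addSubmonoid_fg Q).2 hQ
  exact Algebra.FiniteType.isNoetherianRing k _

variable {k}

theorem coeff_single_smul (q : Q) (r : k) (f : AddMonoidAlgebra k (Fin N → ℤ)) (x : Fin N → ℤ) :
    ((AddMonoidAlgebra.single q r : AddMonoidAlgebra k Q) • f).coeff (q.1 + x) =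
      r * f.coeff x := by
  change (AddMonoidAlgebra.mapDomainRingHom k Q.subtype (AddMonoidAlgebra.single q r) *
    f).coeff (q.1 + x) = _
  simp [AddMonoidAlgebra.coeff_single_mul_apply]

theorem coeff_smul_single (a : AddMonoidAlgebra k Q) (q : Q) (m : Fin N → ℤ) :
    (a • (AddMonoidAlgebra.single m 1 : AddMonoidAlgebra k (Fin N → ℤ))).coeff (q.1 + m) =
      a.coeff q := by
  classical
  induction a using AddMonoidAlgebra.induction_linear with
  | zero => simp
  | add a b ha hb => rw [add_smul]; simp [ha, hb]
  | single p r =>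
    rw [single_smul_single, mul_one, AddMonoidAlgebra.coeff_single, AddMonoidAlgebra.coeff_single,
      Finsupp.single_apply, Finsupp.single_apply]
    exact if_congr (by rw [add_left_inj, Subtype.ext_iff]) rfl rfl

theorem QModule.linearization_mono {U M : QModule Q} (h : U.carrier ⊆ M.carrier) :
    U.linearization k ≤ M.linearization k :=
  fun _ hf x hx => hf x fun hU => hx (h hU)

theorem QModule.single_mem_linearization {M : QModule Q} {m : Fin N → ℤ} (hm : m ∈ M.carrier)
    (c : k) : AddMonoidAlgebra.single m c ∈ M.linearization k := fun x hx => by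
  classical
  rw [AddMonoidAlgebra.coeff_single, Finsupp.single_apply, if_neg]
  rintro rfl
  exact hx hm

theorem single_smul_mem_linearization_iff {U : QModule Q} (q : Q)
    (f : AddMonoidAlgebra k (Fin N → ℤ)) :
    (AddMonoidAlgebra.single q 1 : AddMonoidAlgebra k Q) • f ∈ U.linearization k ↔
      ∀ x, f.coeff x ≠ 0 → q.1 + x ∈ U.carrier := by
  constructor
  · intro h x hx
    by_contra hU
    have := h _ hU
    rw [coeff_single_smul, one_mul] at this
    exact hx this
  · intro h x hx
    obtain ⟨y, rfl⟩ : ∃ y, x = q.1 + y := ⟨-q.1 + x, by simp⟩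
    rw [coeff_single_smul, one_mul]
    by_contra hy
    exact hx (h y hy)

theorem Face.single_mem_ideal_iff (F : Face Q) (q : Q) :
    (AddMonoidAlgebra.single q 1 : AddMonoidAlgebra k Q) ∈ F.ideal k ↔ q.1 ∉ F.carrier := by
  classical
  constructor
  · intro h hq
    have := h q hq
    rw [AddMonoidAlgebra.coeff_single, Finsupp.single_eq_same] at this
    exact one_ne_zero this
  · intro h p hp
    rw [AddMonoidAlgebra.coeff_single, Finsupp.single_apply, if_neg]
    rintro rfl
    exact h hp

theorem Face.ideal_eq_span (F : Face Q) :
    F.ideal k = Ideal.span {a | ∃ q : Q, q.1 ∉ F.carrier ∧ a = AddMonoidAlgebra.single q 1} := by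
  refine le_antisymm (fun f hf => ?_) (Ideal.span_le.2 ?_)
  · rw [← AddMonoidAlgebra.sum_coeff_single f]
    refine Submodule.sum_mem _ fun q hq => ?_
    have hqF : q.1 ∉ F.carrier := fun h => Finsupp.mem_support_iff.1 hq (hf q h)
    have : (AddMonoidAlgebra.single q (f.coeff q) : AddMonoidAlgebra k Q) =
        AddMonoidAlgebra.single 0 (f.coeff q) * AddMonoidAlgebra.single q 1 := by
      rw [AddMonoidAlgebra.single_mul_single, zero_add, mul_one]
    rw [this]
    exact Ideal.mul_mem_left _ _ (Ideal.subset_span ⟨q, hqF, rfl⟩)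
  · rintro a ⟨q, hq, rfl⟩
    exact (F.single_mem_ideal_iff q).2 hq

theorem smul_mem_linearization_of_mem_ideal {U : QModule Q} {F : Face Q}
    {f : AddMonoidAlgebra k (Fin N → ℤ)}
    (h : ∀ x, f.coeff x ≠ 0 → ∀ q ∈ Q, q ∉ F.carrier → q + x ∈ U.carrier)
    {a : AddMonoidAlgebra k Q} (ha : a ∈ F.ideal k) : a • f ∈ U.linearization k := by
  rw [F.ideal_eq_span] at ha
  induction ha using Submodule.span_induction with
  | mem a ha =>
    obtain ⟨q, hq, rfl⟩ := ha
    exact (single_smul_mem_linearization_iff q f).2 fun x hx => h x hx q q.2 hq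
  | zero => simp
  | add a b _ _ ha hb => rw [add_smul]; exact Submodule.add_mem _ ha hb
  | smul c a _ ha => rw [smul_assoc]; exact Submodule.smul_mem _ c ha

/-- The power torsion of `k[M]/k[U]` with respect to `p_F` is spanned by monomials. -/
theorem mk_mem_powerTorsion_iff (hQ : Q.FG) {M U : QModule Q} (F : Face Q)
    (y : M.linearization k) :
    (Submodule.Quotient.mk y : quotientModule k M U) ∈
      (powerTorsion (F.ideal k) : Submodule _ (quotientModule k M U)) ↔
      y.1 ∈ (primaryPart M U F).linearization k := by
  have := isNoetherianRing_of_fg k hQ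
  have hpow : ∀ (q : Q) (n : ℕ), (AddMonoidAlgebra.single q 1 : AddMonoidAlgebra k Q) ^ n •
      (Submodule.Quotient.mk y : quotientModule k M U) = 0 ↔
      ∀ x, y.1.coeff x ≠ 0 → n • q.1 + x ∈ U.carrier := by
    intro q n
    rw [AddMonoidAlgebra.single_pow, one_pow, ← Submodule.Quotient.mk_smul,
      Submodule.Quotient.mk_eq_zero, mem_submoduleOf_iff, Submodule.coe_smul,
      single_smul_mem_linearization_iff]
    rfl
  rw [F.ideal_eq_span, mem_powerTorsion_span_iff (IsNoetherian.noetherian _)]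
  constructor
  · intro h x hx
    by_contra hyx
    refine hx ⟨?_, fun q hq hqF => ?_⟩
    · by_contra hxM
      exact hyx (y.2 x hxM)
    · obtain ⟨n, hn⟩ := h _ ⟨⟨q, hq⟩, hqF, rfl⟩
      exact ⟨n, (hpow ⟨q, hq⟩ n).1 hn x hyx⟩
  · rintro h _ ⟨q, hqF, rfl⟩
    have hex : ∀ x, ∃ n : ℕ, y.1.coeff x ≠ 0 → n • q.1 + x ∈ U.carrier := by
      intro x
      by_cases hx : y.1.coeff x = 0
      · exact ⟨0, fun h => absurd hx h⟩
      · have hxM : x ∈ (primaryPart M U F).carrier := by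
          by_contra hxM
          exact hx (h x hxM)
        exact (hxM.2 q q.2 hqF).imp fun n hn _ => hn
    choose n hn using hex
    -- The support is finite, so one exponent works for all monomials of `y`.
    refine ⟨y.1.coeff.support.sup n, (hpow q _).2 fun x hx => ?_⟩
    obtain ⟨c, hc⟩ := Nat.exists_eq_add_of_le
      (Finset.le_sup (f := n) (Finsupp.mem_support_iff.2 hx))
    rw [hc, add_comm (n x), add_nsmul, add_assoc]
    exact U.add_mem _ (Q.nsmul_mem q.2 c) _ (hn x hx)

/-- The power torsion of `k[M]/k[U]` with respect to `p_F` is `k[M']/k[U]`, where `M'` is the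
`F`-primary part of `M`. -/
theorem primeMultiplicity_eq (hQ : Q.FG) (M U : QModule Q) (F : Face Q) :
    primeMultiplicity (quotientModule k M U) (F.ideal k) =
      localizedLength (F.ideal k) (quotientModule k (primaryPart M U F) U) := by
  let ψ : (primaryPart M U F).linearization k →ₗ[AddMonoidAlgebra k Q]
      (powerTorsion (F.ideal k) : Submodule _ (quotientModule k M U)) :=
    LinearMap.codRestrict _ ((Submodule.mkQ _).comp
      (Submodule.inclusion (QModule.linearization_mono (primaryPart_subset M U F))))
      fun y => (mk_mem_powerTorsion_iff hQ F _).2 y.2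
  have hψ : Function.Surjective ψ := by
    rintro ⟨y, hy⟩
    obtain ⟨y, rfl⟩ := Submodule.Quotient.mk_surjective _ y
    exact ⟨⟨y.1, (mk_mem_powerTorsion_iff hQ F y).1 hy⟩, rfl⟩
  have hker : (U.linearization k).submoduleOf ((primaryPart M U F).linearization k) =
      LinearMap.ker ψ := by
    ext y
    rw [LinearMap.mem_ker, ← Submodule.coe_eq_zero]
    exact (Submodule.Quotient.mk_eq_zero ((U.linearization k).submoduleOf (M.linearization k))
      (x := Submodule.inclusion (QModule.linearization_mono (primaryPart_subset M U F)) y)).symm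
  exact (localizedLength_congr _ ((Submodule.quotEquivOfEq _ _ hker).trans
    (ψ.quotKerEquivOfSurjective hψ))).symm

/-- If `U'` is the disjoint union of `U` and `G + m`, then `k[U']/k[U]` is `k[Q]/p_G`. -/
theorem IsElementaryExtension.nonempty_equiv {U U' : QModule Q} {G : Face Q} {m : Fin N → ℤ}
    (h : IsElementaryExtension U U' G m) :
    Nonempty ((AddMonoidAlgebra k Q ⧸ G.ideal k) ≃ₗ[AddMonoidAlgebra k Q]
      quotientModule k U' U) := by
  let e : U'.linearization k :=
    ⟨AddMonoidAlgebra.single m 1, QModule.single_mem_linearization h.mem 1⟩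
  let ψ := LinearMap.toSpanSingleton (AddMonoidAlgebra k Q) (quotientModule k U' U)
    (Submodule.Quotient.mk e)
  have hψ0 : ∀ a, ψ a = Submodule.Quotient.mk (a • e) := fun a => rfl
  have hψ : Function.Surjective ψ := by
    rw [← LinearMap.range_eq_top, eq_top_iff]
    rintro y -
    obtain ⟨⟨y, hy⟩, rfl⟩ := Submodule.Quotient.mk_surjective _ y
    have hmem : ∀ x ∈ y.coeff.support, x ∈ U'.carrier := fun x hx => by
      by_contra hxU
      exact Finsupp.mem_support_iff.1 hx (hy x hxU)
    have hsum : (⟨y, hy⟩ : U'.linearization k) = ∑ x ∈ y.coeff.support.attach,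
        (⟨AddMonoidAlgebra.single x.1 (y.coeff x.1),
          QModule.single_mem_linearization (hmem x.1 x.2) _⟩ : U'.linearization k) := by
      refine Subtype.ext ?_
      rw [AddSubmonoidClass.coe_finsetSum,
        Finset.sum_attach y.coeff.support fun x => AddMonoidAlgebra.single x (y.coeff x)]
      exact (AddMonoidAlgebra.sum_coeff_single y).symm
    rw [hsum, ← Submodule.mkQ_apply, map_sum]
    refine Submodule.sum_mem _ fun x _ => ?_
    have hx := hmem x.1 x.2
    rw [h.carrier_eq] at hx
    rcases hx with hx | ⟨g, hg, hx⟩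
    · convert Submodule.zero_mem _
      rw [Submodule.mkQ_apply, Submodule.Quotient.mk_eq_zero]
      exact QModule.single_mem_linearization hx _
    · refine ⟨AddMonoidAlgebra.single ⟨g, G.subset hg⟩ (y.coeff x.1), ?_⟩
      rw [hψ0, Submodule.mkQ_apply]
      congr 1
      refine Subtype.ext ?_
      rw [Submodule.coe_smul]
      change AddMonoidAlgebra.single _ _ • AddMonoidAlgebra.single m 1 =
        AddMonoidAlgebra.single _ _
      rw [single_smul_single, mul_one, hx]
  have hker : G.ideal k = LinearMap.ker ψ := by
    ext a
    rw [LinearMap.mem_ker, hψ0, Submodule.Quotient.mk_eq_zero, mem_submoduleOf_iff,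
      Submodule.coe_smul]
    constructor
    · intro ha
      refine smul_mem_linearization_of_mem_ideal (fun x hx q hq hqG => ?_) ha
      have hxm : x = m := by
        by_contra hne
        exact hx (by
          change (AddMonoidAlgebra.single m (1 : k)).coeff x = 0
          rw [AddMonoidAlgebra.coeff_single, Finsupp.single_eq_of_ne hne])
      rw [hxm]
      exact h.add_mem_of_notMem hq hqG
    · intro ha q hq
      rw [← coeff_smul_single a q m]
      exact ha _ (h.avoids q hq)
  exact ⟨(Submodule.quotEquivOfEq _ _ hker).trans (ψ.quotKerEquivOfSurjective hψ)⟩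

/-- Both sides vanish for `U = M` and change equally along an elementary extension: by one if the
adjoined face is `F`, not at all otherwise. -/
theorem localizedLength_eq_encard (hself : (QModule.self Q).AscendingChainCondition)
    {M : QModule Q} (hM : M.AscendingChainCondition) (F : Face Q) {U : QModule Q}
    (hU : U.carrier ⊆ M.carrier)
    (hprim : ∀ m ∈ M.carrier, ∀ q ∈ Q, q ∉ F.carrier → ∃ n : ℕ, n • q + m ∈ U.carrier) :
    (avoidingCosets F M U).encard = localizedLength (F.ideal k) (quotientModule k M U) := by
  revert hprim
  refine QModule.extension_induction hself hM
    (P := fun U => (∀ m ∈ M.carrier, ∀ q ∈ Q, q ∉ F.carrier → ∃ n : ℕ, n • q + m ∈ U.carrier) →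
      (avoidingCosets F M U).encard = localizedLength (F.ideal k) (quotientModule k M U)) ?_ ?_ U hU
  · intro _
    have h1 : avoidingCosets F M M = ∅ := by
      refine Set.eq_empty_of_forall_notMem ?_
      rintro C ⟨n, hn, hav, -⟩
      exact hav.notMem hn
    rw [h1, Set.encard_empty, localizedLength_eq_zero (F.ideal k) (r := 1)
      ((Ideal.ne_top_iff_one _).1 (Face.ideal_isPrime k F).ne_top)]
    intro x
    obtain ⟨x, rfl⟩ := Submodule.Quotient.mk_surjective _ x
    rw [one_smul, Submodule.Quotient.mk_eq_zero]
    exact x.2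
  · intro U U' G m hU' hm hext ih hprim
    have ih := ih fun x hx q hq hqF => (hprim x hx q hq hqF).imp fun _ h => hext.subset h
    obtain ⟨e⟩ := hext.nonempty_equiv (k := k)
    have hadd := localizedLength_submoduleOf (F.ideal k)
      (QModule.linearization_mono (k := k) hext.subset) (QModule.linearization_mono hU')
    refine Eq.trans ?_ hadd.symm
    rw [← localizedLength_congr _ e, ← ih]
    by_cases hFG : F = G
    · subst hFG
      obtain ⟨h1, h2⟩ := hext.avoidingCosets_self hm (hprim m hm)
      rw [h1, Set.encard_insert_of_notMem h2, localizedLength_quotient_self, add_comm]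
    -- Primariness forces `G ⊊ F`. For `q ∈ F ∖ G` the monomial `x^q` kills `k[Q]/p_G` but lies
    -- outside `p_F`, so the localization at `p_F` is zero.
    · have hGF : G.carrier ⊆ F.carrier := by
        intro q hq
        by_contra hqF
        obtain ⟨n, hn⟩ := hprim m hm q (G.subset hq) hqF
        exact hext.avoids _ (G.nsmul_mem hq n) hn
      obtain ⟨q, hqF, hqG⟩ := Set.exists_of_ssubset
        (hGF.ssubset_of_ne fun h => hFG (Face.ext h.symm))
      rw [hext.avoidingCosets_of_ne (hprim m hm) hFG, localizedLength_eq_zero (F.ideal k)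
        (r := AddMonoidAlgebra.single ⟨q, F.subset hqF⟩ 1)
        (fun h => (F.single_mem_ideal_iff _).1 h hqF), zero_add]
      intro x
      obtain ⟨x, rfl⟩ := Submodule.Quotient.mk_surjective _ x
      rw [← Submodule.Quotient.mk_smul, Submodule.Quotient.mk_eq_zero]
      exact Ideal.mul_mem_right _ _ ((G.single_mem_ideal_iff _).2 hqG)

theorem QModule.ascendingChainCondition_of_isNoetherian {M : QModule Q}
    (h : IsNoetherian (AddMonoidAlgebra k Q) (M.linearization k)) :
    M.AscendingChainCondition := by
  have hwf : WellFounded fun U V : Submodule (AddMonoidAlgebra k Q) (M.linearization k) => V < U :=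
    wellFounded_gt
  refine Subrelation.wf ?_ (InvImage.wf (fun U : {U : QModule Q // U.carrier ⊆ M.carrier} =>
    (U.1.linearization k).submoduleOf (M.linearization k)) hwf)
  rintro U V hVU
  refine lt_of_le_not_ge (fun x hx => QModule.linearization_mono hVU.1 hx) fun hle => hVU.2 ?_
  intro x hx
  have := @hle ⟨AddMonoidAlgebra.single x 1, QModule.single_mem_linearization (U.2 hx) 1⟩
    (QModule.single_mem_linearization hx 1)
  by_contra hxV
  have h0 : (AddMonoidAlgebra.single x (1 : k)).coeff x = 0 := this x hxV
  rw [AddMonoidAlgebra.coeff_single, Finsupp.single_eq_same] at h0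
  exact one_ne_zero h0

/-- The chain condition is purely combinatorial, so it can be read off from linearizations over any
one field; `ℚ` is an arbitrary choice. -/
theorem QModule.FG.ascendingChainCondition (hQ : Q.FG) {M : QModule Q} (hM : M.FG) :
    M.AscendingChainCondition := by
  have := isNoetherianRing_of_fg ℚ hQ
  obtain ⟨B, hB⟩ := hM
  let S : Set (AddMonoidAlgebra ℚ (Fin N → ℤ)) :=
    (fun b => AddMonoidAlgebra.single b 1) '' (B : Set (Fin N → ℤ))
  have hS : IsNoetherian (AddMonoidAlgebra ℚ Q) (Submodule.span (AddMonoidAlgebra ℚ Q) S) :=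
    isNoetherian_span_of_finite _ (B.finite_toSet.image _)
  refine QModule.ascendingChainCondition_of_isNoetherian (k := ℚ) (isNoetherian_of_le (t :=
    Submodule.span (AddMonoidAlgebra ℚ Q) S) fun f hf => ?_)
  rw [← AddMonoidAlgebra.sum_coeff_single f]
  refine Submodule.sum_mem _ fun x hx => ?_
  have hxM : x ∈ M.carrier := by
    by_contra hxM
    exact Finsupp.mem_support_iff.1 hx (hf x hxM)
  rw [hB] at hxM
  obtain ⟨q, hq, b, hb, rfl⟩ := hxM
  have h1 := single_smul_single ℚ Q ⟨q, hq⟩ b (f.coeff (q + b)) 1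
  rw [mul_one] at h1
  rw [← h1]
  exact Submodule.smul_mem _ _ (Submodule.subset_span ⟨b, hb, rfl⟩)

theorem QModule.self_fg (Q : AddSubmonoid (Fin N → ℤ)) : (QModule.self Q).FG :=
  ⟨{0}, by ext; simp [QModule.self]⟩

theorem QModule.AscendingChainCondition.of_subset {M M' : QModule Q}
    (hM : M.AscendingChainCondition) (h : M'.carrier ⊆ M.carrier) : M'.AscendingChainCondition :=
  InvImage.wf (fun U : {U : QModule Q // U.carrier ⊆ M'.carrier} =>
    (⟨U.1, U.2.trans h⟩ : {U : QModule Q // U.carrier ⊆ M.carrier})) hM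

/-- The multiplicity of `p_G` on `k[M]/k[U]` counts the translates of `gp(G)` at which `G` is
maximal. -/
theorem encard_maximalCosets (hQ : Q.FG) {M U : QModule Q} (hM : M.FG)
    (hU : U.carrier ⊆ M.carrier) (G : Face Q) :
    (maximalCosets G M U).encard = primeMultiplicity (quotientModule k M U) (G.ideal k) := by
  rw [maximalCosets_eq hQ, primeMultiplicity_eq hQ]
  exact localizedLength_eq_encard ((QModule.self_fg Q).ascendingChainCondition hQ)
    ((hM.ascendingChainCondition hQ).of_subset (primaryPart_subset M U G)) G
    (subset_primaryPart hU G) fun m hm => hm.2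

theorem finite_maximalCosets (hQ : Q.FG) {M U : QModule Q} (hM : M.FG)
    (hU : U.carrier ⊆ M.carrier) (G : Face Q) : (maximalCosets G M U).Finite := by
  rw [maximalCosets_eq hQ]
  exact finite_avoidingCosets ((QModule.self_fg Q).ascendingChainCondition hQ)
    ((hM.ascendingChainCondition hQ).of_subset (primaryPart_subset M U G)) G
    (subset_primaryPart hU G) fun m hm => hm.2

theorem isAssociatedPrime_ideal_iff (hQ : Q.FG) {M U : QModule Q} (G : Face Q) :
    IsAssociatedPrime (G.ideal k) (quotientModule k M U) ↔ ∃ n ∈ M.carrier, IsMaximalAt U G n := by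
  have := isNoetherianRing_of_fg k hQ
  rw [isAssociatedPrime_iff]
  constructor
  · rintro ⟨-, y, hy⟩
    obtain ⟨y, rfl⟩ := Submodule.Quotient.mk_surjective _ y
    have hmem : ∀ q : Q, q.1 ∉ G.carrier ↔ ∀ x, y.1.coeff x ≠ 0 → q.1 + x ∈ U.carrier := by
      intro q
      rw [← G.single_mem_ideal_iff (k := k), hy, Submodule.mem_colon_singleton, Submodule.mem_bot,
        ← Submodule.Quotient.mk_smul, Submodule.Quotient.mk_eq_zero, mem_submoduleOf_iff,
        Submodule.coe_smul, single_smul_mem_linearization_iff]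
    -- Otherwise each monomial of `y` is moved into `U` by some element of `G`; the sum of these
    -- elements lies in `G`, yet its monomial annihilates the class of `y`, so it lies in `p_G`.
    obtain ⟨n, hn, hav⟩ : ∃ n, y.1.coeff n ≠ 0 ∧ Avoids U G n := by
      by_contra! hcon
      have hex : ∀ n, ∃ g ∈ G.carrier, y.1.coeff n ≠ 0 → g + n ∈ U.carrier := by
        intro n
        by_cases hn : y.1.coeff n = 0
        · exact ⟨0, G.zero_mem, fun h => absurd hn h⟩
        · have := hcon n hn
          simp only [Avoids, not_forall, not_not] at this
          obtain ⟨g, hg, h⟩ := this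
          exact ⟨g, hg, fun _ => h⟩
      choose g hg hgU using hex
      have hsum := G.sum_mem y.1.coeff.support g fun x _ => hg x
      refine (hmem ⟨_, G.subset hsum⟩).2 (fun x hx => ?_) hsum
      classical
      change ∑ t ∈ y.1.coeff.support, g t + x ∈ U.carrier
      rw [← Finset.sum_erase_add _ _ (Finsupp.mem_support_iff.2 hx), add_assoc]
      exact U.add_mem _ (G.subset (G.sum_mem _ g fun x _ => hg x)) _ (hgU x hx)
    have hnM : n ∈ M.carrier := by
      by_contra hnM
      exact hn (y.2 n hnM)
    refine ⟨n, hnM, isMaximalAt_of_mem_primaryPart (M := M) ⟨hnM, fun q hq hqG => ⟨1, ?_⟩⟩ hav⟩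
    rw [one_nsmul]
    exact (hmem ⟨q, hq⟩).1 hqG n hn
  · rintro ⟨n, hn, hmax⟩
    obtain ⟨x, hx, hann⟩ := hmax.exists_annihilator_eq
      ((QModule.self_fg Q).ascendingChainCondition hQ) hQ hn
    refine ⟨inferInstance, Submodule.Quotient.mk
      ⟨AddMonoidAlgebra.single x 1, QModule.single_mem_linearization hx 1⟩, ?_⟩
    ext a
    rw [Submodule.mem_colon_singleton, Submodule.mem_bot, ← Submodule.Quotient.mk_smul,
      Submodule.Quotient.mk_eq_zero, mem_submoduleOf_iff,       Submodule.coe_smul]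
    constructor
    · intro ha
      refine smul_mem_linearization_of_mem_ideal (fun z hz q hq hqG => ?_) ha
      have hzx : z = x := by
        by_contra hne
        exact hz (by rw [AddMonoidAlgebra.coeff_single, Finsupp.single_eq_of_ne hne])
      rw [hzx]
      exact (hann q hq).2 hqG
    · intro ha q hq
      rw [← coeff_smul_single a q x]
      exact ha _ fun hU => (hann q q.2).1 hU hq

end Linearization


/-! ### Finite generation of the normalization -/

section Normalization

variable {N : ℕ} {Q : AddSubmonoid (Fin N → ℤ)}

theorem exists_coeff_of_mem_cone {S : Finset (Fin N → ℤ)}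
    (hS : AddSubmonoid.closure (S : Set (Fin N → ℤ)) = Q) {x : Fin N → ℝ} (hx : x ∈ cone Q) :
    ∃ c : (Fin N → ℤ) → ℝ, (∀ s, 0 ≤ c s) ∧ ∀ i, x i = ∑ s ∈ S, c s * s i := by
  classical
  induction hx using Submodule.span_induction with
  | mem x hx =>
    obtain ⟨q, hq, rfl⟩ := hx
    rw [← hS] at hq
    induction hq using AddSubmonoid.closure_induction with
    | mem s hs =>
      refine ⟨fun t => if t = s then 1 else 0, fun t => by positivity, fun i => ?_⟩
      simp [Finset.mem_coe.1 hs]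
    | zero => exact ⟨0, fun _ => le_rfl, fun i => by simp⟩
    | add a b _ _ ha hb =>
      obtain ⟨c, hc, hca⟩ := ha
      obtain ⟨d, hd, hdb⟩ := hb
      refine ⟨c + d, fun s => add_nonneg (hc s) (hd s), fun i => ?_⟩
      have h1 := hca i
      have h2 := hdb i
      simp only at h1 h2
      simp [add_mul, Finset.sum_add_distrib, h1, h2]
  | zero => exact ⟨0, fun _ => le_rfl, fun i => by simp⟩
  | add a b _ _ ha hb =>
    obtain ⟨c, hc, hca⟩ := ha
    obtain ⟨d, hd, hdb⟩ := hb
    refine ⟨c + d, fun s => add_nonneg (hc s) (hd s), fun i => ?_⟩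
    simp [add_mul, Finset.sum_add_distrib, hca, hdb]
  | smul r a _ ha =>
    obtain ⟨c, hc, hca⟩ := ha
    refine ⟨fun s => r.1 * c s, fun s => mul_nonneg r.2 (hc s), fun i => ?_⟩
    change r.1 * a i = _
    rw [hca, Finset.mul_sum]
    exact Finset.sum_congr rfl fun s _ => by ring

theorem self_subset_normalization (Q : AddSubmonoid (Fin N → ℤ)) :
    (QModule.self Q).carrier ⊆ (normalization Q).carrier :=
  fun q hq => ⟨AddSubgroup.subset_closure hq, Submodule.subset_span ⟨q, hq, rfl⟩⟩

/-- Gordan's argument: splitting off the integer parts of the coefficients of a conic combination of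
generators leaves a lattice point of the normalization in a bounded box. -/
theorem normalization_fg (hQ : Q.FG) : (normalization Q).FG := by
  classical
  obtain ⟨S, hS⟩ := hQ
  have hSQ : ∀ s ∈ S, s ∈ Q := fun s hs => hS ▸ AddSubmonoid.subset_closure hs
  -- Bounds every coordinate of a combination of the generators with coefficients in `[0, 1]`.
  let C : ℤ := ∑ s ∈ S, ∑ i, |s i|
  let B : Set (Fin N → ℤ) := (normalization Q).carrier ∩ Set.Icc (fun _ => -C) (fun _ => C)
  have hB : B.Finite := (Set.finite_Icc _ _).subset Set.inter_subset_right
  refine ⟨hB.toFinset, Set.Subset.antisymm ?_ ?_⟩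
  · intro x hx
    obtain ⟨c, hc, hcx⟩ := exists_coeff_of_mem_cone hS hx.2
    let q : Fin N → ℤ := ∑ s ∈ S, ⌊c s⌋₊ • s
    have hq : q ∈ Q := Q.sum_mem fun s hs => Q.nsmul_mem (hSQ s hs) _
    have hb : ∀ i, ((x i - q i : ℤ) : ℝ) = ∑ s ∈ S, (c s - ⌊c s⌋₊) * s i := by
      intro i
      have := hcx i
      push_cast
      rw [this]
      simp [q, Finset.sum_apply, sub_mul, Finset.sum_sub_distrib]
    have hfrac : ∀ s, 0 ≤ c s - ⌊c s⌋₊ ∧ c s - ⌊c s⌋₊ ≤ 1 := fun s =>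
      ⟨sub_nonneg.2 (Nat.floor_le (hc s)), by linarith [Nat.lt_floor_add_one (c s)]⟩
    refine ⟨q, hq, x - q, hB.mem_toFinset.2 ⟨⟨?_, ?_⟩, ?_⟩, by abel⟩
    · exact sub_mem hx.1 (AddSubgroup.subset_closure hq)
    · have hsum : (fun i => (((x - q) i : ℤ) : ℝ)) =
          ∑ s ∈ S, (⟨c s - ⌊c s⌋₊, (hfrac s).1⟩ : {r : ℝ // 0 ≤ r}) •
            (fun i => (s i : ℝ)) := by
        ext i
        rw [Pi.sub_apply, hb, Finset.sum_apply]
        rfl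
      rw [hsum]
      exact Submodule.sum_mem _ fun s hs => Submodule.smul_mem _ _
        (Submodule.subset_span ⟨s, hSQ s hs, rfl⟩)
    · have habs : ∀ i, |x i - q i| ≤ C := by
        intro i
        have : |((x i - q i : ℤ) : ℝ)| ≤ (C : ℝ) := by
          rw [hb]
          refine (Finset.abs_sum_le_sum_abs _ _).trans ?_
          push_cast [C]
          refine Finset.sum_le_sum fun s _ => ?_
          rw [abs_mul, abs_of_nonneg (hfrac s).1]
          refine (mul_le_of_le_one_left (abs_nonneg _) (hfrac s).2).trans ?_
          exact Finset.single_le_sum (f := fun i => |((s i : ℤ) : ℝ)|)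
            (fun i _ => abs_nonneg _) (Finset.mem_univ i)
        exact_mod_cast this
      exact ⟨fun i => (abs_le.1 (habs i)).1, fun i => (abs_le.1 (habs i)).2⟩
  · rintro x ⟨q, hq, b, hb, rfl⟩
    exact (normalization Q).add_mem q hq b (hB.mem_toFinset.1 hb).1

end Normalization

end AffineMonoid
theorem theorem3p9 {N : ℕ} (Q : AddSubmonoid (Fin N → ℤ)) (hQ : Q.FG) :
    (∀ M U : AffineMonoid.QModule Q, M.FG → U.carrier ⊆ M.carrier →
      -- an irredundant finite decomposition exists
      (∃ (r : ℕ) (F : Fin r → AffineMonoid.Face Q) (m : Fin r → (Fin N → ℤ)),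
        AffineMonoid.IsIrredundantDecomposition M U F m) ∧
      -- it is unique up to reordering
      (∀ (r : ℕ) (F : Fin r → AffineMonoid.Face Q) (m : Fin r → (Fin N → ℤ))
        (r' : ℕ) (F' : Fin r' → AffineMonoid.Face Q) (m' : Fin r' → (Fin N → ℤ)),
        AffineMonoid.IsIrredundantDecomposition M U F m →
        AffineMonoid.IsIrredundantDecomposition M U F' m' →
        ∃ σ : Fin r ≃ Fin r', ∀ i, F' (σ i) = F i ∧
          (F' (σ i)).translate (m' (σ i)) = (F i).translate (m i)) ∧
      (∀ (r : ℕ) (F : Fin r → AffineMonoid.Face Q) (m : Fin r → (Fin N → ℤ)),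
        AffineMonoid.IsIrredundantDecomposition M U F m →
        -- over every field, multiplicities and associated primes
        (∀ (k : Type*) [Field k] (G : AffineMonoid.Face Q),
          {i | F i = G}.encard =
            AffineMonoid.primeMultiplicity (AffineMonoid.quotientModule k M U) (G.ideal k) ∧
          ((∃ i, F i = G) ↔
            IsAssociatedPrime (G.ideal k) (AffineMonoid.quotientModule k M U))) ∧
        -- geometric characterization of the pieces
        (∀ (G : AffineMonoid.Face Q), ∀ n ∈ M.carrier,
          (∃ i, F i = G ∧ (F i).translate (m i) = G.translate n) ↔
            (∀ g ∈ G.carrier, g + n ∈ M.carrier \ U.carrier) ∧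
            ∀ H : AffineMonoid.Face Q, G.carrier ⊆ H.carrier →
              (∀ h ∈ H.carrier, h + n ∈ M.carrier \ U.carrier) → H = G))) ∧
    -- the case of the holes: the normalization and `Q` satisfy the hypotheses on `M` and `U`
    ((AffineMonoid.normalization Q).FG ∧
      (AffineMonoid.QModule.self Q).carrier ⊆ (AffineMonoid.normalization Q).carrier) := by
  refine ⟨fun M U hM hU => ⟨?_, ?_, ?_⟩, AffineMonoid.normalization_fg hQ,
    AffineMonoid.self_subset_normalization Q⟩
  · exact AffineMonoid.exists_decomposition hQ (AffineMonoid.finite_pieces hQ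
      (AffineMonoid.finite_maximalCosets hQ hM hU))
  · exact fun r F m r' F' m' h h' => h.exists_equiv hQ h'
  · intro r F m h
    refine ⟨fun k _ G => ⟨?_, ?_⟩, fun G n hn => ?_⟩
    · exact (h.encard_eq hQ G).trans (AffineMonoid.encard_maximalCosets hQ hM hU G)
    · refine Iff.trans ?_ (AffineMonoid.isAssociatedPrime_ideal_iff hQ G).symm
      constructor
      · rintro ⟨i, rfl⟩
        obtain ⟨n, hn, hi⟩ := h.nonempty i
        exact ⟨n, hn, h.isMaximalAt hQ hn hi⟩
      · rintro ⟨n, hn, hmax⟩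
        exact ((h.exists_piece_iff hQ G hn).2 hmax).imp fun i hi => hi.1
    · rw [h.exists_piece_iff hQ G hn, AffineMonoid.avoids_iff hn]
      exact and_congr_right fun _ => forall₂_congr fun H _ => by rw [AffineMonoid.avoids_iff hn]
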